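/- Let $\mathbb T^1=\mathbb R/2\pi\mathbb Z$. Let $\mathcal S=\mathcal S(\mathbb T^1\times\mathbb R)$ be the space of smooth functions $f:\mathbb T^1\times\mathbb R\to\mathbb C$ such that $\|f\|_{\alpha,\beta,\gamma}:=\sup_{(t,x)}|x^\gamma\partial_t^\alpha\partial_x^\beta f(t,x)|<\infty$ for all $\alpha,\beta,\gamma\in\mathbb N_0$. Let $\mathcal S'$ be the space of linear functionals $u:\mathcal S\to\mathbb C$ for which there are $N\in\mathbb N_0$ and $C>0$ with $|\langle u,f\rangle|\le C\sum_{\alpha+\beta+\gamma\le N}\|f\|_{\alpha,\beta,\gamma}$ for all $f\in\mathcal S$. A function $g\in\mathcal S$ is identified with the functional $f\mapsto\int_0^{2\pi}\!\int_{\mathbb R}g(t,x)f(t,x)\,dx\,dt$. Derivatives of $u\in\mathcal S'$ are defined by $\langle\partial_t u,f\rangle=-\langle u,\partial_t f\rangle$ and $\langle\partial_x u,f\rangle=-\langle u,\partial_x f\rangle$; put $D_t=-i\partial_t$ and $D_x=-i\partial_x$. **Theorem.** Let $p,q\in\mathbb C[X]$ be non-constant polynomials in one variable such that $p$ has real coefficients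 or $q$ has real coefficients, and let $$L=p(D_x)+q(D_t):\mathcal S'\to\mathcal S'.$$ Then $L$ is Schwartz globally hypoelliptic (that is, $u\in\mathcal S'$ and $Lu\in\mathcal S$ imply $u\in\mathcal S$) if and only if $$p(\xi)+q(k)\neq 0\qquad\text{for every }(k,\xi)\in\mathbb Z\times\mathbb R.$$ -/

import Mathlib

open scoped ContDiff

noncomputable section

namespace TorusLine

/-! Functions on `𝕋¹ × ℝ`, with `𝕋¹ = ℝ / 2πℤ`, are identified with functions of `(t, x) ∈ ℝ × ℝ`
that are `2π`-periodic in `t`. -/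

/-- The partial derivative in the torus variable `t`. -/
def dt (f : ℝ × ℝ → ℂ) : ℝ × ℝ → ℂ := fun z => deriv (fun s : ℝ => f (s, z.2)) z.1

/-- The partial derivative in the Euclidean variable `x`. -/
def dx (f : ℝ × ℝ → ℂ) : ℝ × ℝ → ℂ := fun z => deriv (fun y : ℝ => f (z.1, y)) z.2

theorem dt_eq_fderiv {f : ℝ × ℝ → ℂ} (hf : ContDiff ℝ ∞ f) :
    dt f = fun z => fderiv ℝ f z (1, 0) := by
  funext z
  have h1 : HasFDerivAt f (fderiv ℝ f z) (z.1, z.2) :=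
    (hf.differentiable (by simp) z).hasFDerivAt
  have h2 : HasDerivAt (fun s : ℝ => (s, z.2)) ((1 : ℝ), (0 : ℝ)) z.1 :=
    (hasDerivAt_id z.1).prodMk (hasDerivAt_const z.1 z.2)
  exact (h1.comp_hasDerivAt z.1 h2).deriv

theorem dx_eq_fderiv {f : ℝ × ℝ → ℂ} (hf : ContDiff ℝ ∞ f) :
    dx f = fun z => fderiv ℝ f z (0, 1) := by
  funext z
  have h1 : HasFDerivAt f (fderiv ℝ f z) (z.1, z.2) :=
    (hf.differentiable (by simp) z).hasFDerivAt
  have h2 : HasDerivAt (fun y : ℝ => (z.1, y)) ((0 : ℝ), (1 : ℝ)) z.2 :=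
    (hasDerivAt_const z.2 z.1).prodMk (hasDerivAt_id z.2)
  exact (h1.comp_hasDerivAt z.2 h2).deriv

theorem contDiff_fderiv_apply {f : ℝ × ℝ → ℂ} (hf : ContDiff ℝ ∞ f) (v : ℝ × ℝ) :
    ContDiff ℝ ∞ (fun z => fderiv ℝ f z v) :=
  (hf.fderiv_right (m := ∞) (by simp)).clm_apply contDiff_const

theorem contDiff_dt {f : ℝ × ℝ → ℂ} (hf : ContDiff ℝ ∞ f) : ContDiff ℝ ∞ (dt f) := by
  rw [dt_eq_fderiv hf]
  exact contDiff_fderiv_apply hf _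

theorem contDiff_dx {f : ℝ × ℝ → ℂ} (hf : ContDiff ℝ ∞ f) : ContDiff ℝ ∞ (dx f) := by
  rw [dx_eq_fderiv hf]
  exact contDiff_fderiv_apply hf _

theorem contDiff_dt_iter {f : ℝ × ℝ → ℂ} (hf : ContDiff ℝ ∞ f) (n : ℕ) :
    ContDiff ℝ ∞ (dt^[n] f) := by
  induction n with
  | zero => exact hf
  | succ n ih => rw [Function.iterate_succ_apply']; exact contDiff_dt ih

theorem contDiff_dx_iter {f : ℝ × ℝ → ℂ} (hf : ContDiff ℝ ∞ f) (n : ℕ) :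
    ContDiff ℝ ∞ (dx^[n] f) := by
  induction n with
  | zero => exact hf
  | succ n ih => rw [Function.iterate_succ_apply']; exact contDiff_dx ih

theorem dx_dt_comm {f : ℝ × ℝ → ℂ} (hf : ContDiff ℝ ∞ f) : dx (dt f) = dt (dx f) := by
  rw [dx_eq_fderiv (contDiff_dt hf), dt_eq_fderiv (contDiff_dx hf), dt_eq_fderiv hf,
    dx_eq_fderiv hf]
  funext z
  have hd : DifferentiableAt ℝ (fderiv ℝ f) z :=
    (hf.fderiv_right (m := ∞) (by simp)).differentiable (by simp) z
  have hs : IsSymmSndFDerivAt ℝ f z :=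
    hf.contDiffAt.isSymmSndFDerivAt
      (by simpa using WithTop.coe_le_coe.2 (le_top : (2 : ℕ∞) ≤ ⊤))
  rw [fderiv_clm_apply hd (differentiableAt_const _),
    fderiv_clm_apply hd (differentiableAt_const _)]
  simpa using hs (0, 1) (1, 0)

theorem dx_iter_dt {f : ℝ × ℝ → ℂ} (hf : ContDiff ℝ ∞ f) (n : ℕ) :
    dx^[n] (dt f) = dt (dx^[n] f) := by
  induction n with
  | zero => rfl
  | succ n ih =>
    rw [Function.iterate_succ_apply', ih, Function.iterate_succ_apply',
      dx_dt_comm (contDiff_dx_iter hf n)]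

theorem dt_add {f g : ℝ × ℝ → ℂ} (hf : ContDiff ℝ ∞ f) (hg : ContDiff ℝ ∞ g) :
    dt (f + g) = dt f + dt g := by
  have hfg : ContDiff ℝ ∞ (f + g) := hf.add hg
  rw [dt_eq_fderiv hf, dt_eq_fderiv hg, dt_eq_fderiv hfg]
  funext z
  rw [fderiv_add (hf.differentiable (by simp) z) (hg.differentiable (by simp) z)]
  rfl

theorem dx_add {f g : ℝ × ℝ → ℂ} (hf : ContDiff ℝ ∞ f) (hg : ContDiff ℝ ∞ g) :
    dx (f + g) = dx f + dx g := by
  have hfg : ContDiff ℝ ∞ (f + g) := hf.add hg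
  rw [dx_eq_fderiv hf, dx_eq_fderiv hg, dx_eq_fderiv hfg]
  funext z
  rw [fderiv_add (hf.differentiable (by simp) z) (hg.differentiable (by simp) z)]
  rfl

theorem dt_smul (c : ℂ) (f : ℝ × ℝ → ℂ) : dt (c • f) = c • dt f := by
  funext z
  exact deriv_const_mul_field (u := c) (v := fun s : ℝ => f (s, z.2))

theorem dx_smul (c : ℂ) (f : ℝ × ℝ → ℂ) : dx (c • f) = c • dx f := by
  funext z
  exact deriv_const_mul_field (u := c) (v := fun y : ℝ => f (z.1, y))

theorem dt_iter_add {f g : ℝ × ℝ → ℂ} (hf : ContDiff ℝ ∞ f) (hg : ContDiff ℝ ∞ g) (n : ℕ) :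
    dt^[n] (f + g) = dt^[n] f + dt^[n] g := by
  induction n with
  | zero => rfl
  | succ n ih =>
    simp only [Function.iterate_succ_apply']
    rw [ih, dt_add (contDiff_dt_iter hf n) (contDiff_dt_iter hg n)]

theorem dx_iter_add {f g : ℝ × ℝ → ℂ} (hf : ContDiff ℝ ∞ f) (hg : ContDiff ℝ ∞ g) (n : ℕ) :
    dx^[n] (f + g) = dx^[n] f + dx^[n] g := by
  induction n with
  | zero => rfl
  | succ n ih =>
    simp only [Function.iterate_succ_apply']
    rw [ih, dx_add (contDiff_dx_iter hf n) (contDiff_dx_iter hg n)]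

theorem dt_iter_smul (c : ℂ) (f : ℝ × ℝ → ℂ) (n : ℕ) : dt^[n] (c • f) = c • dt^[n] f := by
  induction n with
  | zero => rfl
  | succ n ih => simp only [Function.iterate_succ_apply']; rw [ih, dt_smul]

theorem dx_iter_smul (c : ℂ) (f : ℝ × ℝ → ℂ) (n : ℕ) : dx^[n] (c • f) = c • dx^[n] f := by
  induction n with
  | zero => rfl
  | succ n ih => simp only [Function.iterate_succ_apply']; rw [ih, dx_smul]

/-- The weighted derivative `|x|^γ |∂_t^α ∂_x^β f|`. -/
def weighted (f : ℝ × ℝ → ℂ) (α β γ : ℕ) (z : ℝ × ℝ) : ℝ :=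
  |z.2| ^ γ * ‖(dt^[α] (dx^[β] f)) z‖

theorem weighted_nonneg (f : ℝ × ℝ → ℂ) (α β γ : ℕ) (z : ℝ × ℝ) : 0 ≤ weighted f α β γ z := by
  unfold weighted
  positivity

theorem weighted_dt {f : ℝ × ℝ → ℂ} (hf : ContDiff ℝ ∞ f) (α β γ : ℕ) :
    weighted (dt f) α β γ = weighted f (α + 1) β γ := by
  funext z
  simp only [weighted, dx_iter_dt hf, Function.iterate_succ_apply]

theorem weighted_dx (f : ℝ × ℝ → ℂ) (α β γ : ℕ) :
    weighted (dx f) α β γ = weighted f α (β + 1) γ := by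
  funext z
  simp only [weighted, Function.iterate_succ_apply]

/-- The Schwartz space `𝒮(𝕋¹ × ℝ)`: smooth functions, `2π`-periodic in `t`, all of whose
derivatives decay rapidly in `x`, uniformly in `t`. -/
def SchwartzSpace : Submodule ℂ (ℝ × ℝ → ℂ) where
  carrier := {f | ContDiff ℝ ∞ f ∧ (∀ t x : ℝ, f (t + 2 * Real.pi, x) = f (t, x)) ∧
    ∀ α β γ : ℕ, ∃ C : ℝ, ∀ z : ℝ × ℝ, weighted f α β γ z ≤ C}
  zero_mem' := by
    refine ⟨contDiff_const, fun _ _ => rfl, fun α β γ => ⟨0, fun z => ?_⟩⟩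
    have h : dt^[α] (dx^[β] (0 : ℝ × ℝ → ℂ)) = 0 := by
      have h1 := dx_iter_smul 0 (0 : ℝ × ℝ → ℂ) β
      have h2 := dt_iter_smul 0 (0 : ℝ × ℝ → ℂ) α
      simp only [zero_smul] at h1 h2
      rw [h1, h2]
    simp [weighted, h]
  add_mem' := by
    rintro f g ⟨hf, hpf, hbf⟩ ⟨hg, hpg, hbg⟩
    refine ⟨hf.add hg, fun t x => by simp [hpf t x, hpg t x], fun α β γ => ?_⟩
    obtain ⟨A, hA⟩ := hbf α β γ
    obtain ⟨B, hB⟩ := hbg α β γ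
    refine ⟨A + B, fun z => le_trans ?_ (add_le_add (hA z) (hB z))⟩
    simp only [weighted]
    rw [dx_iter_add hf hg, dt_iter_add (contDiff_dx_iter hf β) (contDiff_dx_iter hg β), ← mul_add]
    exact mul_le_mul_of_nonneg_left (norm_add_le _ _) (by positivity)
  smul_mem' := by
    rintro c f ⟨hf, hpf, hbf⟩
    refine ⟨contDiff_const.smul hf, fun t x => by simp [hpf t x], fun α β γ => ?_⟩
    obtain ⟨A, hA⟩ := hbf α β γ
    refine ⟨‖c‖ * A, fun z => ?_⟩
    have h := mul_le_mul_of_nonneg_left (hA z) (norm_nonneg c)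
    simp only [weighted] at h ⊢
    rw [dx_iter_smul, dt_iter_smul, Pi.smul_apply, norm_smul]
    linarith

theorem SchwartzSpace.dt_mem {f : ℝ × ℝ → ℂ} (h : f ∈ SchwartzSpace) : dt f ∈ SchwartzSpace := by
  obtain ⟨hf, hp, hb⟩ := h
  refine ⟨contDiff_dt hf, fun t x => ?_, fun α β γ => ?_⟩
  · have h := deriv_comp_add_const (fun s : ℝ => f (s, x)) (2 * Real.pi) t
    simp only [hp] at h
    exact h.symm
  · rw [weighted_dt hf]
    exact hb (α + 1) β γ

theorem SchwartzSpace.dx_mem {f : ℝ × ℝ → ℂ} (h : f ∈ SchwartzSpace) : dx f ∈ SchwartzSpace := by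
  obtain ⟨hf, hp, hb⟩ := h
  refine ⟨contDiff_dx hf, fun t x => ?_, fun α β γ => ?_⟩
  · simp only [dx, hp]
  · rw [weighted_dx]
    exact hb α (β + 1) γ

/-- `∂_t` on the Schwartz space. -/
def schwartzDt : SchwartzSpace →ₗ[ℂ] SchwartzSpace where
  toFun f := ⟨dt f, SchwartzSpace.dt_mem f.2⟩
  map_add' f g := Subtype.ext (dt_add f.2.1 g.2.1)
  map_smul' c f := Subtype.ext (dt_smul c f)

/-- `∂_x` on the Schwartz space. -/
def schwartzDx : SchwartzSpace →ₗ[ℂ] SchwartzSpace where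
  toFun f := ⟨dx f, SchwartzSpace.dx_mem f.2⟩
  map_add' f g := Subtype.ext (dx_add f.2.1 g.2.1)
  map_smul' c f := Subtype.ext (dx_smul c f)

/-- The seminorm `‖f‖_{α,β,γ} = sup |x^γ ∂_t^α ∂_x^β f|`. -/
def seminormABC (f : SchwartzSpace) (α β γ : ℕ) : ℝ := ⨆ z : ℝ × ℝ, weighted f α β γ z

theorem seminormABC_nonneg (f : SchwartzSpace) (α β γ : ℕ) : 0 ≤ seminormABC f α β γ :=
  Real.iSup_nonneg fun z => weighted_nonneg f α β γ z

/-- The triples `(α, β, γ)` with `α + β + γ ≤ N`. -/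
def triples (N : ℕ) : Finset (ℕ × ℕ × ℕ) :=
  (Finset.range (N + 1) ×ˢ Finset.range (N + 1) ×ˢ Finset.range (N + 1)).filter
    fun a => a.1 + a.2.1 + a.2.2 ≤ N

theorem mem_triples {N : ℕ} {a : ℕ × ℕ × ℕ} : a ∈ triples N ↔ a.1 + a.2.1 + a.2.2 ≤ N := by
  simp only [triples, Finset.mem_filter, Finset.mem_product, Finset.mem_range]
  omega

/-- The norm `p_N(f) = ∑_{α+β+γ ≤ N} ‖f‖_{α,β,γ}`. -/
def pNorm (N : ℕ) (f : SchwartzSpace) : ℝ :=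
  ∑ a ∈ triples N, seminormABC f a.1 a.2.1 a.2.2

theorem pNorm_nonneg (N : ℕ) (f : SchwartzSpace) : 0 ≤ pNorm N f :=
  Finset.sum_nonneg fun _ _ => seminormABC_nonneg f _ _ _

theorem pNorm_mono {M N : ℕ} (h : M ≤ N) (f : SchwartzSpace) : pNorm M f ≤ pNorm N f := by
  refine Finset.sum_le_sum_of_subset_of_nonneg (fun a ha => ?_)
    fun _ _ _ => seminormABC_nonneg f _ _ _
  rw [mem_triples] at ha ⊢
  omega

theorem pNorm_dt_le (N : ℕ) (f : SchwartzSpace) : pNorm N (schwartzDt f) ≤ pNorm (N + 1) f := by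
  have h : pNorm N (schwartzDt f) =
      ∑ a ∈ (triples N).image (fun a : ℕ × ℕ × ℕ => (a.1 + 1, a.2.1, a.2.2)),
        seminormABC f a.1 a.2.1 a.2.2 := by
    rw [Finset.sum_image]
    · refine Finset.sum_congr rfl fun a _ => ?_
      exact congrArg iSup (weighted_dt f.2.1 _ _ _)
    · rintro ⟨a, b, c⟩ _ ⟨a', b', c'⟩ _ hh
      simpa using hh
  rw [h]
  refine Finset.sum_le_sum_of_subset_of_nonneg (fun a ha => ?_)
    fun _ _ _ => seminormABC_nonneg f _ _ _
  obtain ⟨b, hb, rfl⟩ := Finset.mem_image.1 ha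
  rw [mem_triples] at hb ⊢
  simp only
  omega

theorem pNorm_dx_le (N : ℕ) (f : SchwartzSpace) : pNorm N (schwartzDx f) ≤ pNorm (N + 1) f := by
  have h : pNorm N (schwartzDx f) =
      ∑ a ∈ (triples N).image (fun a : ℕ × ℕ × ℕ => (a.1, a.2.1 + 1, a.2.2)),
        seminormABC f a.1 a.2.1 a.2.2 := by
    rw [Finset.sum_image]
    · refine Finset.sum_congr rfl fun a _ => ?_
      exact congrArg iSup (weighted_dx f _ _ _)
    · rintro ⟨a, b, c⟩ _ ⟨a', b', c'⟩ _ hh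
      simpa using hh
  rw [h]
  refine Finset.sum_le_sum_of_subset_of_nonneg (fun a ha => ?_)
    fun _ _ _ => seminormABC_nonneg f _ _ _
  obtain ⟨b, hb, rfl⟩ := Finset.mem_image.1 ha
  rw [mem_triples] at hb ⊢
  simp only
  omega

/-- The space `𝒮'(𝕋¹ × ℝ)` of tempered distributions: the linear functionals `u` on
`𝒮(𝕋¹ × ℝ)` with `|⟨u, f⟩| ≤ C p_N(f)` for some `N` and `C`. -/
def TemperedDistributions : Submodule ℂ (SchwartzSpace →ₗ[ℂ] ℂ) where
  carrier := {u | ∃ (N : ℕ) (C : ℝ), ∀ f : SchwartzSpace, ‖u f‖ ≤ C * pNorm N f}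
  zero_mem' := ⟨0, 0, fun f => by simp⟩
  add_mem' := by
    rintro u v ⟨M, A, hu⟩ ⟨N, B, hv⟩
    refine ⟨max M N, |A| + |B|, fun f => ?_⟩
    have h1 : A * pNorm M f ≤ |A| * pNorm (max M N) f :=
      mul_le_mul (le_abs_self A) (pNorm_mono (le_max_left M N) f) (pNorm_nonneg M f) (abs_nonneg A)
    have h2 : B * pNorm N f ≤ |B| * pNorm (max M N) f :=
      mul_le_mul (le_abs_self B) (pNorm_mono (le_max_right M N) f) (pNorm_nonneg N f) (abs_nonneg B)
    have h3 : ‖(u + v) f‖ ≤ ‖u f‖ + ‖v f‖ := norm_add_le _ _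
    have h4 := hu f
    have h5 := hv f
    rw [add_mul]
    linarith
  smul_mem' := by
    rintro c u ⟨N, C, hu⟩
    refine ⟨N, ‖c‖ * C, fun f => ?_⟩
    rw [LinearMap.smul_apply, norm_smul, mul_assoc]
    exact mul_le_mul_of_nonneg_left (hu f) (norm_nonneg c)

/-- `∂_t` on tempered distributions: `⟨∂_t u, f⟩ = -⟨u, ∂_t f⟩`. -/
def distDt : Module.End ℂ TemperedDistributions where
  toFun u := ⟨-(u.1 ∘ₗ schwartzDt), by
    obtain ⟨N, C, hu⟩ := u.2
    refine ⟨N + 1, |C|, fun f => ?_⟩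
    rw [LinearMap.neg_apply, norm_neg]
    exact (hu (schwartzDt f)).trans (mul_le_mul (le_abs_self C) (pNorm_dt_le N f)
      (pNorm_nonneg N _) (abs_nonneg C))⟩
  map_add' u v := Subtype.ext (LinearMap.ext fun f => neg_add (u.1 (schwartzDt f)) _)
  map_smul' c u := Subtype.ext (LinearMap.ext fun f => (smul_neg c (u.1 (schwartzDt f))).symm)

/-- `∂_x` on tempered distributions: `⟨∂_x u, f⟩ = -⟨u, ∂_x f⟩`. -/
def distDx : Module.End ℂ TemperedDistributions where
  toFun u := ⟨-(u.1 ∘ₗ schwartzDx), by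
    obtain ⟨N, C, hu⟩ := u.2
    refine ⟨N + 1, |C|, fun f => ?_⟩
    rw [LinearMap.neg_apply, norm_neg]
    exact (hu (schwartzDx f)).trans (mul_le_mul (le_abs_self C) (pNorm_dx_le N f)
      (pNorm_nonneg N _) (abs_nonneg C))⟩
  map_add' u v := Subtype.ext (LinearMap.ext fun f => neg_add (u.1 (schwartzDx f)) _)
  map_smul' c u := Subtype.ext (LinearMap.ext fun f => (smul_neg c (u.1 (schwartzDx f))).symm)

/-- A tempered distribution belongs to `𝒮(𝕋¹ × ℝ)` if it is integration over `[0, 2π] × ℝ` against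
a Schwartz function. -/
def IsSchwartz (u : TemperedDistributions) : Prop :=
  ∃ g : SchwartzSpace, ∀ f : SchwartzSpace,
    u.1 f = ∫ t in (0 : ℝ)..(2 * Real.pi), ∫ x : ℝ, g.1 (t, x) * f.1 (t, x)

/-- Schwartz global hypoellipticity: `L u ∈ 𝒮` with `u ∈ 𝒮'` forces `u ∈ 𝒮`. -/
def SchwartzGloballyHypoelliptic (L : Module.End ℂ TemperedDistributions) : Prop :=
  ∀ u : TemperedDistributions, IsSchwartz (L u) → IsSchwartz u

/-- The operator `p(D_x) + q(D_t)` on tempered distributions, where `D_x = -i ∂_x` and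
`D_t = -i ∂_t`; its symbol is `p(ξ) + q(k)`. -/
def constCoeffOp (p q : Polynomial ℂ) : Module.End ℂ TemperedDistributions :=
  Polynomial.aeval (-Complex.I • distDx) p + Polynomial.aeval (-Complex.I • distDt) q

end TorusLine

end

open scoped ContDiff SchwartzMap FourierTransform

noncomputable section

namespace TorusLine

/-! ### Uniform lower bound for a nonvanishing symbol. -/

section LowerBound

open Polynomial Filter Topology

/-! Necessity: the plane wave `e^{i(kt+ξx)}` is an eigenvector of `L` with eigenvalue `p(ξ) + q(k)`.
A zero of the symbol therefore gives a tempered solution of `Lu = 0`, and it is not Schwartz: its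
pairings with test functions of modulus at most 1 are unbounded, whereas a Schwartz `g` keeps such
pairings below the integral of `|g|` (`not_isSchwartz_planeWave`).

Sufficiency has two ingredients. The first is that a symbol without zeros satisfies `|p(ξ) + q(k)| ≥
c > 0` uniformly (`exists_le_norm_symbol`). For a fixed `k` this is coercivity of `p`; the issue is
large `|k|`, and there reality of one polynomial enters. If exactly one of them is real, the
imaginary part of the other controls the symbol, with a compact set of `ξ` treated separately when
`p` is the nonreal one. If both are real, the intermediate value theorem fixes the sign of the
symbol, so `p` and `q` tend to infinity with the same sign and cannot cancel.

The second is that the lower bound makes `L` surjective on the Schwartz space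
(`exists_schwartz_solution`): take Fourier coefficients in `t` and the Fourier transform in `x`, and
divide. All derivatives in `ξ` of the reciprocal symbol are controlled uniformly in `k`, because
`q(k)` is constant in `ξ`.

Regularity follows by duality, with no Fourier analysis of distributions. If `Lu = g` is Schwartz,
choose a Schwartz `w` with `Lw = g`. The transpose of `L` has symbol `p(-ξ) + q(-k)`, obeys the same
bound, and so is also surjective on test functions. Hence `u - w`, which is killed by `L`, vanishes
on every test function, and `u = w`. -/

theorem exists_eventually_le_norm_eval {α : Type*} {l : Filter α} {z : α → ℂ} {d : ℂ[X]}
    (hd : d ≠ 0) (hz : Tendsto (fun a => ‖z a‖) l atTop) :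
    ∃ c : ℝ, 0 < c ∧ ∀ᶠ a in l, c ≤ ‖d.eval (z a)‖ := by
  rcases lt_or_ge 0 d.degree with h | h
  · exact ⟨1, one_pos, (d.tendsto_norm_atTop h hz).eventually_ge_atTop 1⟩
  · have h' := eq_C_of_degree_le_zero h
    have hc : d.coeff 0 ≠ 0 := fun h0 => hd (by rw [h', h0, C_0])
    refine ⟨‖d.coeff 0‖, norm_pos_iff.2 hc, Eventually.of_forall fun a => ?_⟩
    rw [h', eval_C, ← h']

theorem tendsto_norm_ofReal_cocompact :
    Tendsto (fun ξ : ℝ => ‖(ξ : ℂ)‖) (cocompact ℝ) atTop := by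
  exact tendsto_norm_cocompact_atTop.congr fun ξ => (Complex.norm_real ξ).symm

theorem tendsto_norm_intCast_cofinite :
    Tendsto (fun k : ℤ => ‖(k : ℂ)‖) cofinite atTop := by
  have h := (tendsto_norm_cocompact_atTop (E := ℝ)).comp Int.tendsto_coe_cofinite
  refine h.congr fun k => ?_
  simp

theorem exists_le_norm_eval_add {p : ℂ[X]} (hp : 0 < p.natDegree) {w : ℂ}
    (h : ∀ ξ : ℝ, p.eval (ξ : ℂ) + w ≠ 0) :
    ∃ c : ℝ, 0 < c ∧ ∀ ξ : ℝ, c ≤ ‖p.eval (ξ : ℂ) + w‖ := by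
  have hd : 0 < (p + C w).degree := by
    rwa [degree_add_C (natDegree_pos_iff_degree_pos.1 hp), ← natDegree_pos_iff_degree_pos]
  have ht := (p + C w).tendsto_norm_atTop hd tendsto_norm_ofReal_cocompact
  simp only [eval_add, eval_C] at ht
  have hc : Continuous fun ξ : ℝ => ‖p.eval (ξ : ℂ) + w‖ := by fun_prop
  obtain ⟨ξ₀, h₀⟩ := hc.exists_forall_le ht
  exact ⟨_, norm_pos_iff.2 (h ξ₀), h₀⟩

theorem eval_map_conj (p : ℂ[X]) (x : ℝ) :
    (p.map (starRingEnd ℂ)).eval (x : ℂ) = starRingEnd ℂ (p.eval (x : ℂ)) := by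
  rw [eval_map]
  nth_rewrite 1 [← Complex.conj_ofReal x]
  exact eval₂_at_apply _ _

theorem map_conj_eq_self {p : ℂ[X]} (h : ∀ n, (p.coeff n).im = 0) :
    p.map (starRingEnd ℂ) = p := by
  ext n
  rw [coeff_map]
  exact Complex.conj_eq_iff_im.2 (h n)

theorem eval_eq_re {p : ℂ[X]} (h : p.map (starRingEnd ℂ) = p) (x : ℝ) :
    p.eval (x : ℂ) = ((p.eval (x : ℂ)).re : ℂ) := by
  have h' := eval_map_conj p x
  rw [h] at h'
  exact (Complex.conj_eq_iff_re.1 h'.symm).symm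

/-- At a real point `p - p̄` equals `2i Im p`, and adding a real `w` does not change the imaginary
part. -/
theorem norm_eval_sub_map_conj_le {p : ℂ[X]} {w : ℂ} (hw : starRingEnd ℂ w = w) (x : ℝ) :
    ‖(p - p.map (starRingEnd ℂ)).eval (x : ℂ)‖ ≤ 2 * ‖p.eval (x : ℂ) + w‖ := by
  have h : (p - p.map (starRingEnd ℂ)).eval (x : ℂ) =
      (p.eval (x : ℂ) + w) - starRingEnd ℂ (p.eval (x : ℂ) + w) := by
    rw [eval_sub, eval_map_conj, map_add, hw]
    ring
  rw [h]
  refine (norm_sub_le _ _).trans ?_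
  rw [RCLike.norm_conj]
  linarith

/-- Positivity of the symbol at `k = 0` bounds `P` below, so `P` takes large positive values. By the
intermediate value theorem every slice `P + Q k` is then positive, which bounds `Q` below and forces
`Q k` to infinity. -/
theorem eventually_le_of_real {p q : ℂ[X]} (hp : 0 < p.natDegree) (hq : 0 < q.natDegree)
    (hpr : p.map (starRingEnd ℂ) = p) (hqr : q.map (starRingEnd ℂ) = q)
    (h : ∀ (k : ℤ) (ξ : ℝ), p.eval (ξ : ℂ) + q.eval (k : ℂ) ≠ 0)
    (hpos : ∀ ξ : ℝ, 0 < (p.eval (ξ : ℂ)).re + (q.eval ((0 : ℤ) : ℂ)).re) :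
    ∀ᶠ k : ℤ in cofinite, ∀ ξ : ℝ, 1 ≤ ‖p.eval (ξ : ℂ) + q.eval (k : ℂ)‖ := by
  set P : ℝ → ℝ := fun ξ => (p.eval (ξ : ℂ)).re with hP
  set Q : ℤ → ℝ := fun k => (q.eval (k : ℂ)).re with hQ
  have hPe : ∀ ξ : ℝ, p.eval (ξ : ℂ) = (P ξ : ℂ) := eval_eq_re hpr
  have hQe : ∀ k : ℤ, q.eval (k : ℂ) = (Q k : ℂ) := fun k => by
    have := eval_eq_re hqr (k : ℝ)
    simpa using this
  have hpos' : ∀ ξ, 0 < P ξ + Q 0 := hpos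
  have hne : ∀ k ξ, P ξ + Q k ≠ 0 := fun k ξ h0 => h k ξ (by
    rw [hPe, hQe]
    exact_mod_cast h0)
  have hPc : Continuous P := by fun_prop
  have hPt : Tendsto (fun ξ : ℝ => |P ξ|) (cocompact ℝ) atTop := by
    refine (p.tendsto_norm_atTop (natDegree_pos_iff_degree_pos.1 hp)
      tendsto_norm_ofReal_cocompact).congr fun ξ => ?_
    rw [hPe, Complex.norm_real, Real.norm_eq_abs]
  have hQt : Tendsto (fun k : ℤ => |Q k|) cofinite atTop := by
    refine (q.tendsto_norm_atTop (natDegree_pos_iff_degree_pos.1 hq)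
      tendsto_norm_intCast_cofinite).congr fun k => ?_
    rw [hQe, Complex.norm_real, Real.norm_eq_abs]
  have hall : ∀ k ξ, 0 < P ξ + Q k := by
    intro k ξ
    by_contra! hneg
    -- Since `P > -Q 0`, a value of `|P η|` this large can only come from a positive `P η`, and it
    -- outweighs `Q k`.
    obtain ⟨η, hη⟩ := (hPt.eventually_ge_atTop (|Q 0| + |Q k| + 1)).exists
    have hη' : 0 ≤ P η + Q k := by
      have h1 := hpos' η
      have h2 := le_abs_self (Q 0)
      have h3 := neg_abs_le (Q k)
      rcases abs_cases (P η) with ⟨h4, _⟩ | ⟨h4, _⟩ <;> linarith [abs_nonneg (Q k), abs_nonneg (Q 0)]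
    obtain ⟨ζ, hζ⟩ := mem_range_of_exists_le_of_exists_ge (hPc.add continuous_const)
      ⟨ξ, hneg⟩ ⟨η, hη'⟩
    exact hne k ζ hζ
  filter_upwards [hQt.eventually_ge_atTop (|P 0| + |Q 0| + 1)] with k hk ξ
  rw [hPe, hQe, ← Complex.ofReal_add, Complex.norm_real, Real.norm_eq_abs]
  refine le_trans ?_ (le_abs_self _)
  have h1 := hall k 0
  have h2 := hpos' ξ
  have h3 := le_abs_self (Q 0)
  have h4 := le_abs_self (P 0)
  rcases abs_cases (Q k) with ⟨h5, _⟩ | ⟨h5, _⟩ <;> linarith [abs_nonneg (P 0), abs_nonneg (Q 0)]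

theorem exists_eventually_le_norm_symbol {p q : ℂ[X]} (hp : 0 < p.natDegree)
    (hq : 0 < q.natDegree)
    (hreal : p.map (starRingEnd ℂ) = p ∨ q.map (starRingEnd ℂ) = q)
    (h : ∀ (k : ℤ) (ξ : ℝ), p.eval (ξ : ℂ) + q.eval (k : ℂ) ≠ 0) :
    ∃ c : ℝ, 0 < c ∧ ∀ᶠ k : ℤ in cofinite, ∀ ξ : ℝ,
      c ≤ ‖p.eval (ξ : ℂ) + q.eval (k : ℂ)‖ := by
  by_cases hpr : p.map (starRingEnd ℂ) = p
  · by_cases hqr : q.map (starRingEnd ℂ) = q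
    · refine ⟨1, one_pos, ?_⟩
      have hc : Continuous fun ξ : ℝ => (p.eval (ξ : ℂ)).re + (q.eval ((0 : ℤ) : ℂ)).re := by
        fun_prop
      have hne : ∀ ξ : ℝ, (p.eval (ξ : ℂ)).re + (q.eval ((0 : ℤ) : ℂ)).re ≠ 0 := fun ξ h0 => by
        refine h 0 ξ ?_
        have h1 := eval_eq_re hpr ξ
        have h2 := eval_eq_re hqr ((0 : ℤ) : ℝ)
        rw [Complex.ofReal_intCast] at h2
        rw [h1, h2]
        exact_mod_cast h0
      by_cases hpos : ∀ ξ : ℝ, 0 < (p.eval (ξ : ℂ)).re + (q.eval ((0 : ℤ) : ℂ)).re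
      · exact eventually_le_of_real hp hq hpr hqr h hpos
      · have hneg : ∀ ξ : ℝ, (p.eval (ξ : ℂ)).re + (q.eval ((0 : ℤ) : ℂ)).re < 0 := by
          push Not at hpos
          obtain ⟨η, hη⟩ := hpos
          intro ξ
          by_contra! hξ
          obtain ⟨ζ, hζ⟩ := mem_range_of_exists_le_of_exists_ge hc ⟨η, hη⟩ ⟨ξ, hξ⟩
          exact hne ζ hζ
        -- The negative case reduces to the positive one by changing the sign of both polynomials.
        have := eventually_le_of_real (p := -p) (q := -q) (by simpa) (by simpa)
          (by rw [Polynomial.map_neg, hpr]) (by rw [Polynomial.map_neg, hqr])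
          (fun k ξ => by
            rw [eval_neg, eval_neg, ← neg_add]
            exact neg_ne_zero.2 (h k ξ))
          (fun ξ => by
            have := hneg ξ
            rw [eval_neg, eval_neg, Complex.neg_re, Complex.neg_re]
            linarith)
        filter_upwards [this] with k hk ξ
        have := hk ξ
        rwa [eval_neg, eval_neg, ← neg_add, norm_neg] at this
    -- Here `q - q̄` is nonzero but possibly constant, so only a positive lower bound near infinity
    -- is available, not divergence.
    · obtain ⟨c, hc, hev⟩ := exists_eventually_le_norm_eval (sub_ne_zero.2 (Ne.symm hqr))
        tendsto_norm_intCast_cofinite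
      refine ⟨c / 2, by positivity, ?_⟩
      filter_upwards [hev] with k hk ξ
      have h1 := norm_eval_sub_map_conj_le (p := q) (w := p.eval (ξ : ℂ))
        (by rw [← eval_map_conj, hpr]) (k : ℝ)
      rw [Complex.ofReal_intCast, add_comm] at h1
      linarith
  · have hqr := hreal.resolve_left hpr
    obtain ⟨c, hc, hev⟩ := exists_eventually_le_norm_eval (sub_ne_zero.2 (Ne.symm hpr))
      tendsto_norm_ofReal_cocompact
    -- Off the compact `K` the imaginary part of `p` suffices; on `K`, `p` is bounded and `|q(k)|`
    -- dominates.
    obtain ⟨K, hK, hKc⟩ := mem_cocompact.1 hev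
    have hcont : Continuous fun ξ : ℝ => p.eval (ξ : ℂ) := by fun_prop
    obtain ⟨B, hB⟩ := hK.exists_bound_of_continuousOn hcont.continuousOn
    refine ⟨min (c / 2) 1, by positivity, ?_⟩
    have hQt := q.tendsto_norm_atTop (natDegree_pos_iff_degree_pos.1 hq)
      tendsto_norm_intCast_cofinite
    filter_upwards [hQt.eventually_ge_atTop (B + 1)] with k hk ξ
    by_cases hξ : ξ ∈ K
    · refine (min_le_right _ _).trans ?_
      have h1 := hB ξ hξ
      have h2 := norm_sub_le (p.eval (ξ : ℂ) + q.eval (k : ℂ)) (p.eval (ξ : ℂ))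
      rw [add_sub_cancel_left] at h2
      linarith
    · refine (min_le_left _ _).trans ?_
      have h1 := norm_eval_sub_map_conj_le (p := p) (w := q.eval (k : ℂ))
        (by
          have := eval_map_conj q (k : ℝ)
          rw [Complex.ofReal_intCast, hqr] at this
          exact this.symm) ξ
      have h2 : c ≤ _ := hKc hξ
      linarith

theorem exists_le_norm_symbol {p q : ℂ[X]} (hp : 0 < p.natDegree) (hq : 0 < q.natDegree)
    (hreal : (∀ n : ℕ, (p.coeff n).im = 0) ∨ (∀ n : ℕ, (q.coeff n).im = 0))
    (h : ∀ (k : ℤ) (ξ : ℝ), p.eval (ξ : ℂ) + q.eval (k : ℂ) ≠ 0) :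
    ∃ c : ℝ, 0 < c ∧ ∀ (k : ℤ) (ξ : ℝ), c ≤ ‖p.eval (ξ : ℂ) + q.eval (k : ℂ)‖ := by
  obtain ⟨c, hc, hev⟩ := exists_eventually_le_norm_symbol hp hq
    (hreal.imp map_conj_eq_self map_conj_eq_self) h
  choose b hb hle using fun k => exists_le_norm_eval_add hp (h k)
  -- Only finitely many `k` escape the bound `c`, so every sufficiently small positive number lies
  -- below all their individual bounds `b k`.
  have hfin := (eventually_all_finite (l := 𝓝[>] (0 : ℝ)) (p := fun k x => x ≤ b k)
    (eventually_cofinite.1 hev)).2 fun k _ => by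
      filter_upwards [Ioo_mem_nhdsGT (hb k)] with x hx using hx.2.le
  obtain ⟨x, hx, hxc, hx0⟩ := (hfin.and ((eventually_mem_set.2 (Ioo_mem_nhdsGT hc)).and
    self_mem_nhdsWithin)).exists
  refine ⟨x, hx0, fun k ξ => ?_⟩
  by_cases hk : ∀ ξ : ℝ, c ≤ ‖p.eval (ξ : ℂ) + q.eval (k : ℂ)‖
  · exact hxc.2.le.trans (hk ξ)
  · exact (hx k hk).trans (hle k ξ)

end LowerBound

/-! ### Polynomials in intertwined operators. -/

section Intertwining

open Polynomial

/-- Moves a whole polynomial of an operator across a transform once the operator itself has been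
moved; used for the Fourier transform, synthesis, evaluation and the embedding into distributions.
-/
theorem map_aeval_apply {V W : Type*} [AddCommGroup V] [Module ℂ V] [AddCommGroup W] [Module ℂ W]
    (T : V →ₗ[ℂ] W) {A : Module.End ℂ V} {B : Module.End ℂ W} (h : ∀ v, T (A v) = B (T v))
    (p : ℂ[X]) (v : V) : T (aeval A p v) = aeval B p (T v) := by
  induction p using Polynomial.induction_on generalizing v with
  | C a => simp [Algebra.algebraMap_eq_smul_one]
  | add p q hp hq => simp [hp, hq]
  | monomial n a ih =>
    rw [pow_succ, ← mul_assoc, map_mul _ (C a * X ^ n), map_mul _ (C a * X ^ n), aeval_X, aeval_X,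
      Module.End.mul_apply, Module.End.mul_apply, ih, h]

/-- The eigenvector relation says that `z ↦ z • v` intertwines multiplication by `c` on `ℂ` with
`A`. -/
theorem aeval_apply_of_apply_eq_smul {V : Type*} [AddCommGroup V] [Module ℂ V]
    {A : Module.End ℂ V} {c : ℂ} {v : V} (h : A v = c • v) (p : ℂ[X]) :
    aeval A p v = p.eval c • v := by
  have h' := map_aeval_apply (LinearMap.toSpanSingleton ℂ V v) (A := LinearMap.lsmul ℂ ℂ c)
    (B := A) (fun z => by simp [h, smul_smul, mul_comm]) p 1
  have h2 : aeval (LinearMap.lsmul ℂ ℂ c) p (1 : ℂ) = p.eval c := by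
    have : LinearMap.lsmul ℂ ℂ c = Algebra.lmul ℂ ℂ c := by ext; simp
    rw [this, aeval_algHom_apply]
    simp [coe_aeval_eq_eval]
  rw [h2] at h'
  simpa using h'.symm

end Intertwining

/-! ### Rapidly decreasing families and division by the symbol. -/

section Families

open Polynomial SchwartzMap

/-- Families of Schwartz functions all of whose seminorms are bounded. -/
def BoundedFamily (φ : ℤ → 𝓢(ℝ, ℂ)) : Prop :=
  ∀ a n : ℕ, ∃ C : ℝ, ∀ k, SchwartzMap.seminorm ℂ a n (φ k) ≤ C

/-- By continuity each seminorm of `T φ` is dominated by finitely many seminorms of `φ`, with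
constants independent of the family index. -/
theorem BoundedFamily.map {φ : ℤ → 𝓢(ℝ, ℂ)} (hφ : BoundedFamily φ)
    (T : 𝓢(ℝ, ℂ) →L[ℂ] 𝓢(ℝ, ℂ)) : BoundedFamily fun k => T (φ k) := by
  intro a n
  have hw := schwartz_withSeminorms ℂ ℝ ℂ
  obtain ⟨s, C, -, hle⟩ := Seminorm.bound_of_continuous hw
    ((schwartzSeminormFamily ℂ ℝ ℂ (a, n)).comp T.toLinearMap)
    ((hw.continuous_seminorm (a, n)).comp T.continuous)
  choose B hB using hφ
  refine ⟨C * ∑ i ∈ s, B i.1 i.2, fun k => (hle (φ k)).trans ?_⟩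
  rw [smul_apply, NNReal.smul_def, smul_eq_mul]
  refine mul_le_mul_of_nonneg_left ?_ C.2
  refine (Seminorm.le_def.1 (Seminorm.finset_sup_le_sum _ s) _).trans ?_
  rw [sum_apply]
  exact Finset.sum_le_sum fun i _ => hB i.1 i.2 k

theorem BoundedFamily.add {φ ψ : ℤ → 𝓢(ℝ, ℂ)} (hφ : BoundedFamily φ) (hψ : BoundedFamily ψ) :
    BoundedFamily (φ + ψ) := by
  intro a n
  obtain ⟨A, hA⟩ := hφ a n
  obtain ⟨B, hB⟩ := hψ a n
  exact ⟨A + B, fun k => (map_add_le_add _ _ _).trans (add_le_add (hA k) (hB k))⟩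

theorem hasTemperateGrowth_eval (p : ℂ[X]) :
    (fun ξ : ℝ => p.eval (ξ : ℂ)).HasTemperateGrowth := by
  induction p using Polynomial.induction_on' with
  | add p q hp hq =>
    simp only [eval_add]
    exact hp.add hq
  | monomial n a =>
    simp only [eval_monomial]
    exact (Function.HasTemperateGrowth.const a).mul
      (Function.HasTemperateGrowth.pow Function.Complex.hasTemperateGrowth_ofReal n)

/-- With `m' = -P m²`, differentiating `m^j φ` gives `m^j φ'` plus `m^(j+1)` times `-jPφ`, two
expressions of the same shape. Letting `j` and the family vary closes the induction on the order,
and the index `k` enters only through the uniform bound on `m`. -/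
theorem exists_bound_iteratedDeriv_pow_mul {m : ℤ → ℝ → ℂ} {P : ℂ[X]} {B : ℝ}
    (hm : ∀ k (x : ℝ), HasDerivAt (m k) (-(P.eval (x : ℂ)) * m k x ^ 2) x)
    (hs : ∀ k, ContDiff ℝ ∞ (m k)) (hB : ∀ k x, ‖m k x‖ ≤ B) (n : ℕ) :
    ∀ (j a : ℕ) (φ : ℤ → 𝓢(ℝ, ℂ)), BoundedFamily φ → ∃ C : ℝ, ∀ k x,
      |x| ^ a * ‖iteratedDeriv n (fun ξ => m k ξ ^ j * φ k ξ) x‖ ≤ C := by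
  induction n with
  | zero =>
    intro j a φ hφ
    obtain ⟨C, hC⟩ := hφ a 0
    have hB0 : 0 ≤ B := (norm_nonneg _).trans (hB 0 0)
    refine ⟨B ^ j * C, fun k x => ?_⟩
    have h1 := (le_seminorm' ℂ a 0 (φ k) x).trans (hC k)
    rw [iteratedDeriv_zero] at h1 ⊢
    rw [norm_mul, norm_pow, mul_left_comm]
    exact mul_le_mul (pow_le_pow_left₀ (norm_nonneg _) (hB k x) j) h1 (by positivity)
      (by positivity)
  | succ n ih =>
    intro j a φ hφ
    obtain ⟨C₁, hC₁⟩ := ih j a _ (hφ.map (derivCLM ℂ ℂ))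
    obtain ⟨C₂, hC₂⟩ := ih (j + 1) a _
      (hφ.map (smulLeftCLM ℂ (fun ξ : ℝ => (-(C (j : ℂ) * P)).eval (ξ : ℂ))))
    refine ⟨C₁ + C₂, fun k x => ?_⟩
    have hd : deriv (fun ξ => m k ξ ^ j * φ k ξ) =
        (fun ξ => m k ξ ^ j * derivCLM ℂ ℂ (φ k) ξ) + fun ξ => m k ξ ^ (j + 1) *
          smulLeftCLM ℂ (fun ξ : ℝ => (-(C (j : ℂ) * P)).eval (ξ : ℂ)) (φ k) ξ := by
      funext y
      rw [(((hm k y).fun_pow j).fun_mul ((φ k).hasDerivAt y)).deriv, Pi.add_apply, derivCLM_apply,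
        smulLeftCLM_apply_apply (hasTemperateGrowth_eval _)]
      simp only [smul_eq_mul, eval_neg, eval_mul, eval_C]
      rcases j with _ | j
      · simp
      · simp only [Nat.add_sub_cancel]
        ring
    have hs1 : ∀ (i : ℕ) (ψ : 𝓢(ℝ, ℂ)), ContDiff ℝ n (fun ξ => m k ξ ^ i * ψ ξ) := fun i ψ =>
      (((hs k).pow i).mul (ψ.smooth ⊤)).of_le (mod_cast le_top)
    rw [iteratedDeriv_succ', hd, iteratedDeriv_add (hs1 _ _).contDiffAt (hs1 _ _).contDiffAt]
    refine (mul_le_mul_of_nonneg_left (norm_add_le _ _) (by positivity)).trans ?_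
    rw [mul_add]
    exact add_le_add (hC₁ k x) (hC₂ k x)

/-- Families of Schwartz functions that decrease rapidly in the index, in every seminorm. -/
def RapidFamilies : Submodule ℂ (ℤ → 𝓢(ℝ, ℂ)) where
  carrier := {φ | ∀ N : ℕ, BoundedFamily fun k => (k : ℂ) ^ N • φ k}
  zero_mem' := fun N a n => ⟨0, fun k => by simp⟩
  add_mem' := by
    intro φ ψ hφ hψ N
    convert (hφ N).add (hψ N) using 1
    funext k
    simp
  smul_mem' := by
    intro c φ hφ N
    convert (hφ N).map (c • ContinuousLinearMap.id ℂ _) using 1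
    funext k
    simp [smul_smul, mul_comm]

theorem RapidFamilies.map_mem {φ : ℤ → 𝓢(ℝ, ℂ)} (hφ : φ ∈ RapidFamilies)
    (T : 𝓢(ℝ, ℂ) →L[ℂ] 𝓢(ℝ, ℂ)) : (fun k => T (φ k)) ∈ RapidFamilies := by
  intro N
  simpa using (hφ N).map T

theorem RapidFamilies.intCast_smul_mem {φ : ℤ → 𝓢(ℝ, ℂ)} (hφ : φ ∈ RapidFamilies) :
    (fun k : ℤ => (k : ℂ) • φ k) ∈ RapidFamilies := by
  intro N
  simpa [smul_smul, pow_succ] using hφ (N + 1)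

/-- The termwise action of a continuous operator on rapidly decreasing families. -/
def rapidMap (T : 𝓢(ℝ, ℂ) →L[ℂ] 𝓢(ℝ, ℂ)) : Module.End ℂ RapidFamilies where
  toFun φ := ⟨fun k => T (φ.1 k), RapidFamilies.map_mem φ.2 T⟩
  map_add' φ ψ := by ext; simp
  map_smul' c φ := by ext; simp

/-- Multiplication of the `k`-th member of a family by `k`. -/
def rapidIndex : Module.End ℂ RapidFamilies where
  toFun φ := ⟨fun k => (k : ℂ) • φ.1 k, RapidFamilies.intCast_smul_mem φ.2⟩
  map_add' φ ψ := by ext; simp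
  map_smul' c φ := by ext; simp; ring

/-- The `k`-th member of a family. -/
def rapidEval (k : ℤ) : RapidFamilies →ₗ[ℂ] 𝓢(ℝ, ℂ) where
  toFun φ := φ.1 k
  map_add' _ _ := rfl
  map_smul' _ _ := rfl

theorem aeval_rapidMap_apply (T : 𝓢(ℝ, ℂ) →L[ℂ] 𝓢(ℝ, ℂ)) (p : ℂ[X]) (φ : RapidFamilies)
    (k : ℤ) : (aeval (rapidMap T) p φ).1 k = aeval (T : Module.End ℂ 𝓢(ℝ, ℂ)) p (φ.1 k) :=
  map_aeval_apply (rapidEval k) (fun _ => rfl) p φ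

theorem aeval_rapidIndex_apply (q : ℂ[X]) (φ : RapidFamilies) (k : ℤ) :
    (aeval rapidIndex q φ).1 k = q.eval (k : ℂ) • φ.1 k := by
  have h := map_aeval_apply (rapidEval k) (A := rapidIndex)
    (B := (k : ℂ) • (1 : Module.End ℂ 𝓢(ℝ, ℂ))) (fun _ => rfl) q φ
  rw [aeval_apply_of_apply_eq_smul (A := (k : ℂ) • (1 : Module.End ℂ 𝓢(ℝ, ℂ))) rfl] at h
  exact h

/-- The quotient is `m φ_k` with `m` the reciprocal symbol, whose derivative is `-P' m²`. The
factors `k^N` commute with `m`, so uniform bounds for the families `k^N φ_k` pass to the quotient.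
-/
theorem exists_rapid_div {P q : ℂ[X]} {c : ℝ} (hc : 0 < c)
    (h : ∀ (k : ℤ) (ξ : ℝ), c ≤ ‖P.eval (ξ : ℂ) + q.eval (k : ℂ)‖) (φ : RapidFamilies) :
    ∃ ψ : RapidFamilies, ∀ (k : ℤ) (ξ : ℝ),
      P.eval (ξ : ℂ) * ψ.1 k ξ + q.eval (k : ℂ) * ψ.1 k ξ = φ.1 k ξ := by
  set m : ℤ → ℝ → ℂ := fun k ξ => (P.eval (ξ : ℂ) + q.eval (k : ℂ))⁻¹ with hm
  have hne : ∀ (k : ℤ) (ξ : ℝ), P.eval (ξ : ℂ) + q.eval (k : ℂ) ≠ 0 := fun k ξ =>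
    norm_pos_iff.1 (hc.trans_le (h k ξ))
  have hsm : ∀ k, ContDiff ℝ ∞ (m k) := fun k =>
    ((hasTemperateGrowth_eval P).1.add contDiff_const).inv (hne k)
  have hder : ∀ k (x : ℝ), HasDerivAt (m k) (-(P.derivative.eval (x : ℂ)) * m k x ^ 2) x := by
    intro k x
    have h1 : HasDerivAt (fun ξ : ℝ => P.eval (ξ : ℂ) + q.eval (k : ℂ))
        (P.derivative.eval (x : ℂ)) x := ((P.hasDerivAt (x : ℂ)).comp_ofReal).add_const _
    refine (h1.fun_inv (hne k x)).congr_deriv ?_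
    change _ = _ * ((P.eval (x : ℂ) + q.eval (k : ℂ))⁻¹) ^ 2
    field_simp
  have hB : ∀ k x, ‖m k x‖ ≤ c⁻¹ := fun k x => by
    change ‖(P.eval (x : ℂ) + q.eval (k : ℂ))⁻¹‖ ≤ _
    rw [norm_inv]
    exact inv_anti₀ hc (h k x)
  have key := fun n => exists_bound_iteratedDeriv_pow_mul hder hsm hB n 1
  simp only [pow_one] at key
  have hd : ∀ (k : ℤ) (a n : ℕ), ∃ C : ℝ, ∀ x,
      ‖x‖ ^ a * ‖iteratedFDeriv ℝ n (fun ξ => m k ξ * φ.1 k ξ) x‖ ≤ C := by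
    intro k a n
    -- The weight `k^0` is trivial, so this is the decay needed for each single quotient to be a
    -- Schwartz function.
    obtain ⟨C, hC⟩ := key n a _ (φ.2 0)
    refine ⟨C, fun x => ?_⟩
    have := hC k x
    simpa only [pow_zero, one_smul, Real.norm_eq_abs, norm_iteratedFDeriv_eq_norm_iteratedDeriv]
      using this
  let ψ : ℤ → 𝓢(ℝ, ℂ) := fun k =>
    ⟨fun ξ => m k ξ * φ.1 k ξ, (hsm k).mul ((φ.1 k).smooth ⊤), hd k⟩
  have hψ : ∀ k ξ, ψ k ξ = m k ξ * φ.1 k ξ := fun _ _ => rfl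
  refine ⟨⟨ψ, fun N a n => ?_⟩, fun k ξ => ?_⟩
  · obtain ⟨C, hC⟩ := key n a _ (φ.2 N)
    refine ⟨C, fun k => seminorm_le_bound' ℂ a n _
      (le_trans (by positivity) (hC k 0)) fun x => ?_⟩
    have h1 : ((k : ℂ) ^ N • ψ k : 𝓢(ℝ, ℂ)) = fun ξ => m k ξ * ((k : ℂ) ^ N • φ.1 k) ξ := by
      funext ξ
      simp [hψ]
      ring
    rw [h1]
    exact hC k x
  · simp only [hψ, hm]
    have := hne k ξ
    field_simp

end Families

/-! ### Solving the equation coefficient by coefficient. -/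

section Resolvent

open Polynomial SchwartzMap

/-- `-i d/dx` on the Schwartz space of the line. -/
def lineD : 𝓢(ℝ, ℂ) →L[ℂ] 𝓢(ℝ, ℂ) := -Complex.I • derivCLM ℂ ℂ

/-- Multiplication by `2πξ` on the Schwartz space of the line. -/
def mulFreq : 𝓢(ℝ, ℂ) →L[ℂ] 𝓢(ℝ, ℂ) :=
  smulLeftCLM ℂ fun ξ : ℝ => (C (2 * (Real.pi : ℂ)) * X : ℂ[X]).eval (ξ : ℂ)

theorem mulFreq_apply (φ : 𝓢(ℝ, ℂ)) (ξ : ℝ) : mulFreq φ ξ = 2 * Real.pi * ξ * φ ξ := by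
  rw [mulFreq, smulLeftCLM_apply_apply (hasTemperateGrowth_eval _)]
  simp

theorem aeval_mulFreq_apply (p : ℂ[X]) (φ : 𝓢(ℝ, ℂ)) (ξ : ℝ) :
    aeval (mulFreq : Module.End ℂ 𝓢(ℝ, ℂ)) p φ ξ = p.eval (2 * Real.pi * ξ : ℂ) * φ ξ := by
  let T : 𝓢(ℝ, ℂ) →ₗ[ℂ] ℂ :=
    { toFun := fun f => f ξ, map_add' := fun _ _ => rfl, map_smul' := fun _ _ => rfl }
  have h := map_aeval_apply T (A := (mulFreq : Module.End ℂ 𝓢(ℝ, ℂ)))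
    (B := (2 * Real.pi * ξ : ℂ) • (1 : Module.End ℂ ℂ)) (fun f => mulFreq_apply f ξ) p φ
  rw [aeval_apply_of_apply_eq_smul (A := (2 * Real.pi * ξ : ℂ) • (1 : Module.End ℂ ℂ)) rfl] at h
  exact h

/-- The inverse transform has kernel `e^{2πixξ}`, so `-i d/dx` brings down `2πξ`. -/
theorem lineD_fourierInv (φ : 𝓢(ℝ, ℂ)) : lineD (𝓕⁻ φ) = 𝓕⁻ (mulFreq φ) := by
  have h := lineDerivOp_fourierInv_eq φ (1 : ℝ)
  have h1 : (LineDeriv.lineDerivOp (1 : ℝ) (𝓕⁻ φ) : 𝓢(ℝ, ℂ)) = derivCLM ℂ ℂ (𝓕⁻ φ) := by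
    ext x
    rw [derivCLM_apply]
    exact lineDerivOp_apply_eq_fderiv ..
  have h2 : mulFreq φ = -Complex.I • ((2 * Real.pi * Complex.I) •
      smulLeftCLM ℂ (fun x : ℝ => (inner ℝ x (1 : ℝ) : ℝ)) φ) := by
    ext x
    have ht : (fun x : ℝ => (inner ℝ x (1 : ℝ) : ℝ)).HasTemperateGrowth := by fun_prop
    rw [smul_apply, smul_apply, smulLeftCLM_apply_apply ht, mulFreq_apply]
    simp
    linear_combination (2 * Real.pi * x * φ x : ℂ) * Complex.I_mul_I
  rw [lineD, smul_apply, ← h1, h, h2]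
  exact (FourierTransform.fourierInv_smul ..).symm

theorem aeval_lineD_fourierInv (p : ℂ[X]) (φ : 𝓢(ℝ, ℂ)) :
    aeval (lineD : Module.End ℂ 𝓢(ℝ, ℂ)) p (𝓕⁻ φ) =
      𝓕⁻ (aeval (mulFreq : Module.End ℂ 𝓢(ℝ, ℂ)) p φ) :=
  (map_aeval_apply (FourierTransform.fourierInvCLM ℂ 𝓢(ℝ, ℂ) : 𝓢(ℝ, ℂ) →ₗ[ℂ] 𝓢(ℝ, ℂ))
    (fun f => (lineD_fourierInv f).symm) p φ).symm

theorem exists_rapid_solution {p q : ℂ[X]} {c : ℝ} (hc : 0 < c)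
    (h : ∀ (k : ℤ) (ξ : ℝ), c ≤ ‖p.eval (ξ : ℂ) + q.eval (k : ℂ)‖) (φ : RapidFamilies) :
    ∃ ψ : RapidFamilies, aeval (rapidMap lineD) p ψ + aeval rapidIndex q ψ = φ := by
  -- The frequency variable is rescaled by `2π`; the lower bound survives because it holds at every
  -- real point.
  obtain ⟨χ, hχ⟩ := exists_rapid_div (P := p.comp (C (2 * (Real.pi : ℂ)) * X)) (q := q) hc
    (fun k ξ => by simpa using h k (2 * Real.pi * ξ))
    (rapidMap (FourierTransform.fourierCLM ℂ 𝓢(ℝ, ℂ)) φ)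
  refine ⟨rapidMap (FourierTransform.fourierInvCLM ℂ 𝓢(ℝ, ℂ)) χ, Subtype.ext (funext fun k => ?_)⟩
  have h1 : aeval (mulFreq : Module.End ℂ 𝓢(ℝ, ℂ)) p (χ.1 k) + q.eval (k : ℂ) • χ.1 k =
      𝓕 (φ.1 k) := by
    ext ξ
    have := hχ k ξ
    simp only [eval_comp, eval_mul, eval_C, eval_X] at this
    rw [add_apply, smul_apply, aeval_mulFreq_apply]
    exact this
  have h2 : aeval (lineD : Module.End ℂ 𝓢(ℝ, ℂ)) p (𝓕⁻ (χ.1 k)) + q.eval (k : ℂ) • 𝓕⁻ (χ.1 k) =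
      φ.1 k := by
    rw [aeval_lineD_fourierInv, ← FourierTransform.fourierInv_smul,
      ← FourierTransform.fourierInv_add, h1]
    exact FourierTransform.fourierInv_fourier_eq _
  change (aeval (rapidMap lineD) p _).1 k + (aeval rapidIndex q _).1 k = _
  rw [aeval_rapidMap_apply, aeval_rapidIndex_apply]
  exact h2

end Resolvent

/-! ### Fourier synthesis in the torus variable. -/

section Synthesis

open SchwartzMap

/-- The character `t ↦ e^{ikt}` of the torus. -/
def torusChar (k : ℤ) (t : ℝ) : ℂ := Complex.exp (k * Complex.I * t)

theorem hasDerivAt_torusChar (k : ℤ) (t : ℝ) :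
    HasDerivAt (torusChar k) (k * Complex.I * torusChar k t) t := by
  have h := (((hasDerivAt_id (t : ℂ)).const_mul (k * Complex.I)).cexp).comp_ofReal
  refine h.congr_deriv ?_
  simp [torusChar, mul_comm]

theorem contDiff_torusChar (k : ℤ) : ContDiff ℝ ∞ (torusChar k) := by
  exact (contDiff_const.mul Complex.ofRealCLM.contDiff).cexp

theorem norm_torusChar (k : ℤ) (t : ℝ) : ‖torusChar k t‖ = 1 := by
  have : (k * Complex.I * t : ℂ) = ((k * t : ℝ) : ℂ) * Complex.I := by
    push_cast
    ring
  rw [torusChar, this, Complex.norm_exp_ofReal_mul_I]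

theorem torusChar_add_two_pi (k : ℤ) (t : ℝ) : torusChar k (t + 2 * Real.pi) = torusChar k t := by
  have : (k * Complex.I * ((t + 2 * Real.pi : ℝ) : ℂ) : ℂ) =
      k * Complex.I * t + k * (2 * Real.pi * Complex.I) := by
    push_cast
    ring
  rw [torusChar, this, Complex.exp_add, Complex.exp_int_mul_two_pi_mul_I, mul_one, torusChar]

theorem torusChar_neg_mul (k : ℤ) (t : ℝ) : torusChar (-k) t * torusChar k t = 1 := by
  rw [torusChar, torusChar, ← Complex.exp_add]
  simp

theorem iteratedDeriv_torusChar (k : ℤ) (n : ℕ) :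
    iteratedDeriv n (torusChar k) = fun t => (k * Complex.I) ^ n * torusChar k t := by
  induction n with
  | zero => simp
  | succ n ih =>
    rw [iteratedDeriv_succ, ih]
    funext t
    rw [((hasDerivAt_torusChar k t).const_mul _).deriv]
    ring

theorem RapidFamilies.exists_bound (φ : RapidFamilies) (N a n : ℕ) :
    ∃ C : ℝ, ∀ k : ℤ, |(k : ℝ)| ^ N * SchwartzMap.seminorm ℂ a n (φ.1 k) ≤ C := by
  obtain ⟨C, hC⟩ := φ.2 N a n
  refine ⟨C, fun k => ?_⟩
  have := hC k
  rwa [map_smul_eq_mul, norm_pow, Complex.norm_intCast] at this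

/-- Two spare powers of `k` give comparison with the convergent series of `1/k²`. -/
theorem RapidFamilies.summable (φ : RapidFamilies) (N a n : ℕ) :
    Summable fun k : ℤ => |(k : ℝ)| ^ N * SchwartzMap.seminorm ℂ a n (φ.1 k) := by
  obtain ⟨C, hC⟩ := RapidFamilies.exists_bound φ (N + 2) a n
  refine Summable.of_norm_bounded_eventually
    ((Real.summable_one_div_int_pow.2 one_lt_two).mul_left C) ?_
  -- At `k = 0` the comparison term is `1/0 = 0`, so that index is discarded.
  refine Filter.mem_of_superset ((Set.finite_singleton (0 : ℤ)).compl_mem_cofinite) fun k hk => ?_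
  have hk' : (0 : ℝ) < (k : ℝ) ^ 2 := by
    have : (k : ℝ) ≠ 0 := Int.cast_ne_zero.2 hk
    positivity
  have h := hC k
  rw [pow_add, sq_abs, mul_right_comm] at h
  rw [Set.mem_ofPred_eq, Real.norm_of_nonneg (mul_nonneg (by positivity) (apply_nonneg _ _)),
    mul_one_div, le_div_iff₀ hk']
  exact h

theorem norm_iteratedFDeriv_comp_clm_le {E F : Type*} [NormedAddCommGroup E] [NormedSpace ℝ E]
    [NormedAddCommGroup F] [NormedSpace ℝ F] (g : E →L[ℝ] F) (hg : ‖g‖ ≤ 1) {f : F → ℂ}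
    (hf : ContDiff ℝ ∞ f) (n : ℕ) (x : E) :
    ‖iteratedFDeriv ℝ n (fun y => f (g y)) x‖ ≤ ‖iteratedFDeriv ℝ n f (g x)‖ := by
  have h := g.iteratedFDeriv_comp_right hf x (i := n) (mod_cast le_top)
  change ‖iteratedFDeriv ℝ n (f ∘ g) x‖ ≤ _
  rw [h]
  refine (ContinuousMultilinearMap.norm_compContinuousLinearMap_le _ _).trans ?_
  refine mul_le_of_le_one_right (norm_nonneg _) ?_
  exact Finset.prod_le_one (fun _ _ => norm_nonneg _) fun _ _ => hg

/-- The function `e^{ikt} φ_k(x)`. -/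
def synthTerm (φ : RapidFamilies) (k : ℤ) (z : ℝ × ℝ) : ℂ := torusChar k z.1 * φ.1 k z.2

theorem norm_synthTerm_le (φ : RapidFamilies) (a : ℕ) (k : ℤ) (z : ℝ × ℝ) :
    |z.2| ^ a * ‖synthTerm φ k z‖ ≤ SchwartzMap.seminorm ℂ a 0 (φ.1 k) := by
  rw [synthTerm, norm_mul, norm_torusChar, one_mul]
  exact norm_pow_mul_le_seminorm ℂ (φ.1 k) a z.2

theorem contDiff_synthTerm (φ : RapidFamilies) (k : ℤ) : ContDiff ℝ ∞ (synthTerm φ k) :=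
  ((contDiff_torusChar k).comp contDiff_fst).mul (((φ.1 k).smooth ⊤).comp contDiff_snd)

/-- Leibniz rule: `i` derivatives of the character cost `|k|^i`, which rapid decay absorbs. This is
the summable majorant that makes the synthesized series smooth. -/
theorem norm_iteratedFDeriv_synthTerm_le (φ : RapidFamilies) (k : ℤ) (n : ℕ) (z : ℝ × ℝ) :
    ‖iteratedFDeriv ℝ n (synthTerm φ k) z‖ ≤ ∑ i ∈ Finset.range (n + 1),
      (n.choose i : ℝ) * (|(k : ℝ)| ^ i * SchwartzMap.seminorm ℂ 0 (n - i) (φ.1 k)) := by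
  refine (norm_iteratedFDeriv_mul_le ((contDiff_torusChar k).comp contDiff_fst)
    (((φ.1 k).smooth ⊤).comp contDiff_snd) z (mod_cast le_top)).trans ?_
  refine Finset.sum_le_sum fun i _ => ?_
  rw [mul_assoc]
  refine mul_le_mul_of_nonneg_left (mul_le_mul ?_ ?_ (norm_nonneg _) (by positivity))
    (by positivity)
  · refine (norm_iteratedFDeriv_comp_clm_le (ContinuousLinearMap.fst ℝ ℝ ℝ)
      (ContinuousLinearMap.norm_fst_le ..) (contDiff_torusChar k) i z).trans ?_
    rw [norm_iteratedFDeriv_eq_norm_iteratedDeriv, iteratedDeriv_torusChar]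
    simp [norm_torusChar]
  · exact (norm_iteratedFDeriv_comp_clm_le (ContinuousLinearMap.snd ℝ ℝ ℝ)
      (ContinuousLinearMap.norm_snd_le ..) ((φ.1 k).smooth ⊤) (n - i) z).trans
      (norm_iteratedFDeriv_le_seminorm ℂ (φ.1 k) (n - i) _)

theorem summable_synthTerm (φ : RapidFamilies) (z : ℝ × ℝ) :
    Summable fun k => synthTerm φ k z :=
  Summable.of_norm_bounded (RapidFamilies.summable φ 0 0 0) fun k => by
    simpa using norm_synthTerm_le φ 0 k z

/-- The function `∑ e^{ikt} φ_k(x)`. -/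
def synth (φ : RapidFamilies) (z : ℝ × ℝ) : ℂ := ∑' k, synthTerm φ k z

theorem contDiff_synth (φ : RapidFamilies) : ContDiff ℝ ∞ (synth φ) := by
  have h := contDiff_tsum (𝕜 := ℝ) (N := ⊤) (f := synthTerm φ)
    (v := fun n k => ∑ i ∈ Finset.range (n + 1),
      (n.choose i : ℝ) * (|(k : ℝ)| ^ i * SchwartzMap.seminorm ℂ 0 (n - i) (φ.1 k)))
    (contDiff_synthTerm φ)
    (fun n _ => summable_sum fun i _ => (RapidFamilies.summable φ i 0 (n - i)).mul_left _)
    (fun n k z _ => norm_iteratedFDeriv_synthTerm_le φ k n z)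
  exact h

theorem dt_synth (φ : RapidFamilies) : dt (synth φ) = synth (Complex.I • rapidIndex φ) := by
  funext z
  refine (hasDerivAt_tsum (u := fun k : ℤ => |(k : ℝ)| ^ 1 * SchwartzMap.seminorm ℂ 0 0 (φ.1 k))
    (g := fun k s => synthTerm φ k (s, z.2))
    (g' := fun k s => synthTerm (Complex.I • rapidIndex φ) k (s, z.2))
    (RapidFamilies.summable φ 1 0 0) (fun k s => ?_) (fun k s => ?_)
    (summable_synthTerm φ (0, z.2)) z.1).deriv
  · refine ((hasDerivAt_torusChar k s).mul_const (φ.1 k z.2)).congr_deriv ?_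
    simp [synthTerm, rapidIndex]
    ring
  · have h := norm_synthTerm_le φ 0 k (s, z.2)
    have h2 : synthTerm (Complex.I • rapidIndex φ) k (s, z.2) =
        Complex.I * k * synthTerm φ k (s, z.2) := by
      simp [synthTerm, rapidIndex]
      ring
    rw [h2, norm_mul, norm_mul, Complex.norm_I, one_mul, Complex.norm_intCast, pow_one]
    rw [pow_zero, one_mul] at h
    gcongr

theorem dx_synth (φ : RapidFamilies) : dx (synth φ) = synth (rapidMap (derivCLM ℂ ℂ) φ) := by
  funext z
  refine (hasDerivAt_tsum
    (u := fun k : ℤ => |(k : ℝ)| ^ 0 *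
      SchwartzMap.seminorm ℂ 0 0 ((rapidMap (derivCLM ℂ ℂ) φ).1 k))
    (g := fun k y => synthTerm φ k (z.1, y))
    (g' := fun k y => synthTerm (rapidMap (derivCLM ℂ ℂ) φ) k (z.1, y))
    (RapidFamilies.summable (rapidMap (derivCLM ℂ ℂ) φ) 0 0 0) (fun k y => ?_) (fun k y => ?_)
    (summable_synthTerm φ (z.1, 0)) z.2).deriv
  · exact ((φ.1 k).hasDerivAt y).const_mul (torusChar k z.1)
  · simpa using norm_synthTerm_le (rapidMap (derivCLM ℂ ℂ) φ) 0 k (z.1, y)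

theorem synth_add_two_pi (φ : RapidFamilies) (t x : ℝ) :
    synth φ (t + 2 * Real.pi, x) = synth φ (t, x) := by
  simp only [synth, synthTerm, torusChar_add_two_pi]

theorem norm_synth_le (φ : RapidFamilies) (a : ℕ) (z : ℝ × ℝ) :
    |z.2| ^ a * ‖synth φ z‖ ≤ ∑' k, SchwartzMap.seminorm ℂ a 0 (φ.1 k) := by
  have hs : Summable fun k => SchwartzMap.seminorm ℂ a 0 (φ.1 k) := by
    simpa using RapidFamilies.summable φ 0 a 0
  have h : ((|z.2| : ℝ) : ℂ) ^ a * synth φ z = ∑' k, ((|z.2| : ℝ) : ℂ) ^ a * synthTerm φ k z :=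
    tsum_mul_left.symm
  have h2 : ‖∑' k, ((|z.2| : ℝ) : ℂ) ^ a * synthTerm φ k z‖ ≤
      ∑' k, SchwartzMap.seminorm ℂ a 0 (φ.1 k) :=
    tsum_of_norm_bounded hs.hasSum fun k => by
      simpa using norm_synthTerm_le φ a k z
  rw [← h] at h2
  simpa using h2

/-- Both derivatives of a synthesized function are again synthesized from rapid families, so every
weighted bound reduces to one without derivatives. -/
theorem exists_iterate_eq_synth (φ : RapidFamilies) (α β : ℕ) :
    ∃ ψ : RapidFamilies, dt^[α] (dx^[β] (synth φ)) = synth ψ := by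
  have h1 : ∃ ψ : RapidFamilies, dx^[β] (synth φ) = synth ψ := by
    induction β with
    | zero => exact ⟨φ, rfl⟩
    | succ n ih =>
      obtain ⟨ψ, hψ⟩ := ih
      exact ⟨_, by rw [Function.iterate_succ_apply', hψ, dx_synth]⟩
  obtain ⟨χ, hχ⟩ := h1
  rw [hχ]
  induction α with
  | zero => exact ⟨χ, rfl⟩
  | succ n ih =>
    obtain ⟨ψ, hψ⟩ := ih
    exact ⟨_, by rw [Function.iterate_succ_apply', hψ, dt_synth]⟩

theorem synth_mem (φ : RapidFamilies) : synth φ ∈ SchwartzSpace := by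
  refine ⟨contDiff_synth φ, synth_add_two_pi φ, fun α β γ => ?_⟩
  obtain ⟨ψ, hψ⟩ := exists_iterate_eq_synth φ α β
  refine ⟨∑' k, SchwartzMap.seminorm ℂ γ 0 (ψ.1 k), fun z => ?_⟩
  rw [weighted, hψ]
  exact norm_synth_le ψ γ z

/-- Synthesis of a Schwartz function on `𝕋¹ × ℝ` from its Fourier coefficients in `t`. -/
def schwartzSynth : RapidFamilies →ₗ[ℂ] SchwartzSpace where
  toFun φ := ⟨synth φ, synth_mem φ⟩
  map_add' φ ψ := by
    refine Subtype.ext (funext fun z => ?_)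
    refine Eq.trans ?_ ((summable_synthTerm φ z).tsum_add (summable_synthTerm ψ z))
    exact tsum_congr fun k => mul_add (torusChar k z.1) (φ.1 k z.2) (ψ.1 k z.2)
  map_smul' c φ := by
    refine Subtype.ext (funext fun z => ?_)
    refine Eq.trans ?_ (tsum_mul_left (a := c) (f := fun k => synthTerm φ k z))
    exact tsum_congr fun k => mul_left_comm (torusChar k z.1) c (φ.1 k z.2)

theorem schwartzSynth_rapidIndex (φ : RapidFamilies) :
    schwartzSynth (rapidIndex φ) = (-Complex.I • schwartzDt) (schwartzSynth φ) := by
  have h : schwartzDt (schwartzSynth φ) = schwartzSynth (Complex.I • rapidIndex φ) :=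
    Subtype.ext (dt_synth φ)
  rw [LinearMap.smul_apply, h, map_smul, smul_smul]
  simp

theorem schwartzSynth_rapidMap_lineD (φ : RapidFamilies) :
    schwartzSynth (rapidMap lineD φ) = (-Complex.I • schwartzDx) (schwartzSynth φ) := by
  have h : schwartzDx (schwartzSynth φ) = schwartzSynth (rapidMap (derivCLM ℂ ℂ) φ) :=
    Subtype.ext (dx_synth φ)
  have h2 : rapidMap lineD φ = -Complex.I • rapidMap (derivCLM ℂ ℂ) φ := rfl
  rw [LinearMap.smul_apply, h, h2, map_smul]

end Synthesis

/-! ### Fourier coefficients in the torus variable, and solvability in the Schwartz space. -/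

section Analysis

open SchwartzMap MeasureTheory

theorem SchwartzSpace.dt_iterate_mem {f : ℝ × ℝ → ℂ} (h : f ∈ SchwartzSpace) (n : ℕ) :
    dt^[n] f ∈ SchwartzSpace := by
  induction n with
  | zero => exact h
  | succ n ih => rw [Function.iterate_succ_apply']; exact SchwartzSpace.dt_mem ih

theorem SchwartzSpace.dx_iterate_mem {f : ℝ × ℝ → ℂ} (h : f ∈ SchwartzSpace) (n : ℕ) :
    dx^[n] f ∈ SchwartzSpace := by
  induction n with
  | zero => exact h
  | succ n ih => rw [Function.iterate_succ_apply']; exact SchwartzSpace.dx_mem ih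

theorem SchwartzSpace.exists_bound {f : ℝ × ℝ → ℂ} (h : f ∈ SchwartzSpace) (a : ℕ) :
    ∃ C : ℝ, ∀ z : ℝ × ℝ, |z.2| ^ a * ‖f z‖ ≤ C :=
  h.2.2 0 0 a

theorem hasDerivAt_dx {f : ℝ × ℝ → ℂ} (hf : ContDiff ℝ ∞ f) (t x : ℝ) :
    HasDerivAt (fun y => f (t, y)) (dx f (t, x)) x := by
  have h : Differentiable ℝ fun y : ℝ => f (t, y) :=
    (hf.comp (contDiff_const.prodMk contDiff_id)).differentiable (by simp)
  exact (h x).hasDerivAt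

theorem hasDerivAt_dt {f : ℝ × ℝ → ℂ} (hf : ContDiff ℝ ∞ f) (t x : ℝ) :
    HasDerivAt (fun s => f (s, x)) (dt f (t, x)) t := by
  have h : Differentiable ℝ fun s : ℝ => f (s, x) :=
    (hf.comp (contDiff_id.prodMk contDiff_const)).differentiable (by simp)
  exact (h t).hasDerivAt

/-- The `k`-th Fourier coefficient of `f(·, x)`. -/
def torusCoeff (f : ℝ × ℝ → ℂ) (k : ℤ) (x : ℝ) : ℂ :=
  (1 / (2 * Real.pi) : ℝ) • ∫ t in (0 : ℝ)..(2 * Real.pi), torusChar (-k) t * f (t, x)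

theorem norm_torusCoeff_le {f : ℝ × ℝ → ℂ} (k : ℤ) (x : ℝ) {C : ℝ}
    (h : ∀ t, ‖f (t, x)‖ ≤ C) : ‖torusCoeff f k x‖ ≤ C := by
  have h1 := intervalIntegral.norm_integral_le_of_norm_le_const (a := 0) (b := 2 * Real.pi)
    (f := fun t => torusChar (-k) t * f (t, x)) (C := C) fun t _ => by
      rw [norm_mul, norm_torusChar, one_mul]
      exact h t
  have hpi := Real.two_pi_pos
  rw [sub_zero, abs_of_pos hpi] at h1
  rw [torusCoeff, norm_smul, Real.norm_of_nonneg (by positivity), one_div, inv_mul_le_iff₀ hpi]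
  linarith

theorem pow_mul_norm_torusCoeff_le {f : ℝ × ℝ → ℂ} {a : ℕ} {C : ℝ}
    (h : ∀ z : ℝ × ℝ, |z.2| ^ a * ‖f z‖ ≤ C) (k : ℤ) (x : ℝ) :
    |x| ^ a * ‖torusCoeff f k x‖ ≤ C := by
  have h1 : torusCoeff (fun z => ((|x| ^ a : ℝ) : ℂ) * f z) k x =
      ((|x| ^ a : ℝ) : ℂ) * torusCoeff f k x := by
    simp only [torusCoeff, mul_left_comm _ ((|x| ^ a : ℝ) : ℂ)]
    rw [intervalIntegral.integral_const_mul, mul_smul_comm]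
  have h2 := norm_torusCoeff_le (f := fun z => ((|x| ^ a : ℝ) : ℂ) * f z) k x (C := C) fun t => by
    have := h (t, x)
    simpa using this
  rw [h1] at h2
  simpa using h2

/-- Differentiation under the integral, dominated by a constant because `∂_x f` is bounded and the
interval is finite. -/
theorem hasDerivAt_torusCoeff {f : ℝ × ℝ → ℂ} (hf : f ∈ SchwartzSpace) (k : ℤ) (x : ℝ) :
    HasDerivAt (torusCoeff f k) (torusCoeff (dx f) k x) x := by
  obtain ⟨C, hC⟩ := SchwartzSpace.exists_bound (SchwartzSpace.dx_mem hf) 0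
  have hc : ∀ {g : ℝ × ℝ → ℂ}, ContDiff ℝ ∞ g → ∀ y : ℝ,
      Continuous fun t => torusChar (-k) t * g (t, y) := fun hg y =>
    (contDiff_torusChar (-k)).continuous.mul
      (hg.continuous.comp (continuous_id.prodMk continuous_const))
  have h := (intervalIntegral.hasDerivAt_integral_of_dominated_loc_of_deriv_le
    (μ := volume) (a := 0) (b := 2 * Real.pi) (x₀ := x) (s := Set.univ) (bound := fun _ => C)
    (F := fun y t => torusChar (-k) t * f (t, y))
    (F' := fun y t => torusChar (-k) t * dx f (t, y)) Filter.univ_mem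
    (Filter.Eventually.of_forall fun y => (hc hf.1 y).aestronglyMeasurable)
    ((hc hf.1 x).intervalIntegrable _ _)
    ((hc (contDiff_dx hf.1) x).aestronglyMeasurable)
    (Filter.Eventually.of_forall fun t _ y _ => by
      rw [norm_mul, norm_torusChar, one_mul]
      simpa using hC (t, y))
    intervalIntegrable_const
    (Filter.Eventually.of_forall fun t _ y _ =>
      (hasDerivAt_dx hf.1 t y).const_mul _)).2
  exact h.const_smul (1 / (2 * Real.pi) : ℝ)

theorem iteratedDeriv_torusCoeff {f : ℝ × ℝ → ℂ} (hf : f ∈ SchwartzSpace) (k : ℤ) (n : ℕ) :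
    iteratedDeriv n (torusCoeff f k) = torusCoeff (dx^[n] f) k := by
  induction n with
  | zero => simp
  | succ n ih =>
    rw [iteratedDeriv_succ, ih, Function.iterate_succ_apply']
    exact funext fun x => (hasDerivAt_torusCoeff (SchwartzSpace.dx_iterate_mem hf n) k x).deriv

theorem contDiff_torusCoeff {f : ℝ × ℝ → ℂ} (hf : f ∈ SchwartzSpace) (k : ℤ) :
    ContDiff ℝ ∞ (torusCoeff f k) :=
  contDiff_of_differentiable_iteratedDeriv fun m _ => by
    rw [iteratedDeriv_torusCoeff hf]
    exact fun x => (hasDerivAt_torusCoeff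
      (SchwartzSpace.dx_iterate_mem hf m) k x).differentiableAt

/-- Integration by parts; periodicity cancels the boundary terms. -/
theorem torusCoeff_dt {f : ℝ × ℝ → ℂ} (hf : f ∈ SchwartzSpace) (k : ℤ) (x : ℝ) :
    torusCoeff (dt f) k x = k * Complex.I * torusCoeff f k x := by
  have hd : ∀ t, HasDerivAt (fun s => torusChar (-k) s * f (s, x))
      (torusChar (-k) t * dt f (t, x) - k * Complex.I * (torusChar (-k) t * f (t, x))) t := by
    intro t
    refine ((hasDerivAt_torusChar (-k) t).fun_mul (hasDerivAt_dt hf.1 t x)).congr_deriv ?_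
    push_cast
    ring
  have hc : ∀ {g : ℝ × ℝ → ℂ}, ContDiff ℝ ∞ g →
      Continuous fun t => torusChar (-k) t * g (t, x) := fun hg =>
    (contDiff_torusChar (-k)).continuous.mul
      (hg.continuous.comp (continuous_id.prodMk continuous_const))
  have h1 := hc (contDiff_dt hf.1)
  have h2 : Continuous fun t => k * Complex.I * (torusChar (-k) t * f (t, x)) :=
    continuous_const.mul (hc hf.1)
  have h := intervalIntegral.integral_eq_sub_of_hasDerivAt (a := 0) (b := 2 * Real.pi)
    (fun t _ => hd t) ((h1.sub h2).intervalIntegrable _ _)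
  have hper : torusChar (-k) (2 * Real.pi) * f (2 * Real.pi, x) = torusChar (-k) 0 * f (0, x) := by
    have e1 := torusChar_add_two_pi (-k) 0
    have e2 := hf.2.1 0 x
    rw [zero_add] at e1 e2
    rw [e1, e2]
  rw [intervalIntegral.integral_sub (h1.intervalIntegrable _ _) (h2.intervalIntegrable _ _), hper,
    sub_self, intervalIntegral.integral_const_mul, sub_eq_zero] at h
  rw [torusCoeff, h, torusCoeff, mul_smul_comm]

theorem torusCoeff_dt_iterate {f : ℝ × ℝ → ℂ} (hf : f ∈ SchwartzSpace) (k : ℤ) (x : ℝ) (n : ℕ) :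
    torusCoeff (dt^[n] f) k x = (k * Complex.I) ^ n * torusCoeff f k x := by
  induction n with
  | zero => simp
  | succ n ih =>
    rw [Function.iterate_succ_apply', torusCoeff_dt (SchwartzSpace.dt_iterate_mem hf n), ih]
    ring

theorem exists_bound_iteratedDeriv_torusCoeff {f : ℝ × ℝ → ℂ} (hf : f ∈ SchwartzSpace)
    (a n : ℕ) : ∃ C : ℝ, ∀ (k : ℤ) (x : ℝ),
      |x| ^ a * ‖iteratedDeriv n (torusCoeff f k) x‖ ≤ C := by
  obtain ⟨C, hC⟩ := SchwartzSpace.exists_bound (SchwartzSpace.dx_iterate_mem hf n) a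
  refine ⟨C, fun k x => ?_⟩
  rw [iteratedDeriv_torusCoeff hf]
  exact pow_mul_norm_torusCoeff_le hC k x

/-- The `k`-th Fourier coefficient in `t` of a Schwartz function on `𝕋¹ × ℝ`. -/
def schwartzCoeff (f : SchwartzSpace) (k : ℤ) : 𝓢(ℝ, ℂ) where
  toFun := torusCoeff f.1 k
  smooth' := contDiff_torusCoeff f.2 k
  decay' := fun a n => by
    obtain ⟨C, hC⟩ := exists_bound_iteratedDeriv_torusCoeff f.2 a n
    refine ⟨C, fun x => ?_⟩
    rw [Real.norm_eq_abs, norm_iteratedFDeriv_eq_norm_iteratedDeriv]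
    exact hC k x

theorem boundedFamily_schwartzCoeff (f : SchwartzSpace) : BoundedFamily (schwartzCoeff f) := by
  intro a n
  obtain ⟨C, hC⟩ := exists_bound_iteratedDeriv_torusCoeff f.2 a n
  exact ⟨C, fun k => seminorm_le_bound' ℂ a n _ (le_trans (by positivity) (hC k 0)) (hC k)⟩

/-- Up to the factor `(-i)^N`, `k^N` times the coefficient of `f` is the coefficient of `∂_t^N f`,
and coefficients of any Schwartz function form a bounded family. -/
theorem schwartzCoeff_mem (f : SchwartzSpace) : schwartzCoeff f ∈ RapidFamilies := by
  intro N
  convert (boundedFamily_schwartzCoeff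
    ⟨_, SchwartzSpace.dt_iterate_mem f.2 N⟩).map ((-Complex.I) ^ N • ContinuousLinearMap.id ℂ _)
    using 1
  funext k
  ext x
  change (k : ℂ) ^ N * torusCoeff f.1 k x = (-Complex.I) ^ N * torusCoeff (dt^[N] f.1) k x
  rw [torusCoeff_dt_iterate f.2, ← mul_assoc, ← mul_pow]
  congr 2
  linear_combination (k : ℂ) * Complex.I_mul_I

/-- With `x` frozen, `f(·, x)` descends to a continuous function on the circle, where summable
Fourier coefficients imply pointwise convergence. -/
theorem hasSum_torusCoeff {f : ℝ × ℝ → ℂ} (hf : f ∈ SchwartzSpace) (x : ℝ)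
    (hs : Summable fun k => torusCoeff f k x) (t : ℝ) :
    HasSum (fun k => torusChar k t * torusCoeff f k x) (f (t, x)) := by
  have : Fact (0 < 2 * Real.pi) := ⟨Real.two_pi_pos⟩
  have hper : Function.Periodic (fun s => f (s, x)) (2 * Real.pi) := fun s => hf.2.1 s x
  have hcont : Continuous (hper.lift) :=
    (hf.1.continuous.comp (continuous_id.prodMk continuous_const)).quotient_liftOn' _
  let F : C(AddCircle (2 * Real.pi), ℂ) := ⟨hper.lift, hcont⟩
  have hchar : ∀ (k : ℤ) (s : ℝ), fourier k (s : AddCircle (2 * Real.pi)) = torusChar k s := by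
    intro k s
    rw [fourier_coe_apply, torusChar]
    congr 1
    have : (Real.pi : ℂ) ≠ 0 := by exact_mod_cast Real.pi_ne_zero
    push_cast
    field_simp
  have hcoef : fourierCoeff F = fun k => torusCoeff f k x := by
    funext k
    rw [fourierCoeff_eq_intervalIntegral _ _ 0, zero_add]
    simp only [hchar]
    rfl
  have h := has_pointwise_sum_fourier_series_of_summable (f := F) (by rw [hcoef]; exact hs)
    (t : AddCircle (2 * Real.pi))
  simp only [hcoef, hchar, smul_eq_mul] at h
  have hF : F (t : AddCircle (2 * Real.pi)) = f (t, x) := hper.lift_coe t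
  rw [hF] at h
  simpa only [mul_comm] using h

/-- Fourier inversion in `t`: synthesis is onto, so solving for families of coefficients solves the
equation for functions. -/
theorem schwartzSynth_schwartzCoeff (f : SchwartzSpace) :
    schwartzSynth ⟨schwartzCoeff f, schwartzCoeff_mem f⟩ = f := by
  refine Subtype.ext (funext fun z => ?_)
  refine (hasSum_torusCoeff f.2 z.2 ?_ z.1).tsum_eq
  refine Summable.of_norm_bounded
    (RapidFamilies.summable ⟨schwartzCoeff f, schwartzCoeff_mem f⟩ 0 0 0) fun k => ?_
  rw [pow_zero, one_mul]
  exact norm_le_seminorm ℂ (schwartzCoeff f k) z.2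

open Polynomial in
theorem exists_schwartz_solution {p q : ℂ[X]} {c : ℝ} (hc : 0 < c)
    (h : ∀ (k : ℤ) (ξ : ℝ), c ≤ ‖p.eval (ξ : ℂ) + q.eval (k : ℂ)‖) (g : SchwartzSpace) :
    ∃ f : SchwartzSpace,
      aeval (-Complex.I • schwartzDx) p f + aeval (-Complex.I • schwartzDt) q f = g := by
  obtain ⟨ψ, hψ⟩ := exists_rapid_solution hc h ⟨schwartzCoeff g, schwartzCoeff_mem g⟩
  refine ⟨schwartzSynth ψ, ?_⟩
  rw [← map_aeval_apply schwartzSynth schwartzSynth_rapidMap_lineD,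
    ← map_aeval_apply schwartzSynth schwartzSynth_rapidIndex, ← map_add, hψ,
    schwartzSynth_schwartzCoeff]

end Analysis

/-! ### Functions as tempered distributions, and integration by parts. -/

section Pairing

open SchwartzMap MeasureTheory

/-- The seminorms with weights `1` and `x²` add up to control of `(1 + x²)|f|`. This integrable
majorant justifies Fubini and bounds all the pairings. -/
theorem norm_le_pNorm (f : SchwartzSpace) (z : ℝ × ℝ) :
    ‖f.1 z‖ ≤ pNorm 2 f * (1 + z.2 ^ 2)⁻¹ := by
  have h : ∀ a, |z.2| ^ a * ‖f.1 z‖ ≤ seminormABC f 0 0 a := fun a => by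
    obtain ⟨C, hC⟩ := f.2.2.2 0 0 a
    exact le_ciSup (f := weighted f.1 0 0 a) ⟨C, by rintro _ ⟨y, rfl⟩; exact hC y⟩ z
  have hsum : seminormABC f 0 0 0 + seminormABC f 0 0 2 ≤ pNorm 2 f := by
    have hsub : ({(0, 0, 0), (0, 0, 2)} : Finset (ℕ × ℕ × ℕ)) ⊆ triples 2 := by
      intro a ha
      rw [mem_triples]
      simp only [Finset.mem_insert, Finset.mem_singleton] at ha
      rcases ha with rfl | rfl <;> simp
    refine le_trans (le_of_eq ?_) (Finset.sum_le_sum_of_subset_of_nonneg hsub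
      fun _ _ _ => seminormABC_nonneg f _ _ _)
    rw [Finset.sum_pair (by simp)]
  have h0 := h 0
  have h2 := h 2
  rw [sq_abs] at h2
  rw [← div_eq_mul_inv, le_div_iff₀ (by positivity)]
  linarith

/-- Lebesgue measure on `(0, 2π] × ℝ`. -/
def cylMeasure : Measure (ℝ × ℝ) :=
  (volume.restrict (Set.Ioc 0 (2 * Real.pi))).prod volume

theorem integrable_weight : Integrable (fun z : ℝ × ℝ => (1 + z.2 ^ 2)⁻¹) cylMeasure :=
  integrable_inv_one_add_sq.comp_snd _

/-- The pairing `∫ a f` over `[0, 2π] × ℝ`. -/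
def cylPairing (a f : ℝ × ℝ → ℂ) : ℂ :=
  ∫ t in (0 : ℝ)..(2 * Real.pi), ∫ x : ℝ, a (t, x) * f (t, x)

theorem norm_mul_le_weight {a : ℝ × ℝ → ℂ} {B : ℝ} (hB : ∀ z, ‖a z‖ ≤ B) (f : SchwartzSpace)
    (z : ℝ × ℝ) : ‖a z * f.1 z‖ ≤ B * pNorm 2 f * (1 + z.2 ^ 2)⁻¹ := by
  rw [norm_mul, mul_assoc]
  exact mul_le_mul (hB z) (norm_le_pNorm f z) (norm_nonneg _) ((norm_nonneg _).trans (hB z))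

theorem integrable_mul_schwartz {a : ℝ × ℝ → ℂ} (ha : Continuous a) {B : ℝ}
    (hB : ∀ z, ‖a z‖ ≤ B) (f : SchwartzSpace) : Integrable (fun z => a z * f.1 z) cylMeasure :=
  (integrable_weight.const_mul (B * pNorm 2 f)).mono'
    (ha.mul f.2.1.continuous).aestronglyMeasurable
    (Filter.Eventually.of_forall (norm_mul_le_weight hB f))

theorem integrable_mul_schwartz_line {a : ℝ × ℝ → ℂ} (ha : Continuous a) {B : ℝ}
    (hB : ∀ z, ‖a z‖ ≤ B) (f : SchwartzSpace) (t : ℝ) :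
    Integrable fun x : ℝ => a (t, x) * f.1 (t, x) :=
  (integrable_inv_one_add_sq.const_mul (B * pNorm 2 f)).mono'
    ((ha.mul f.2.1.continuous).comp
      (continuous_const.prodMk continuous_id)).aestronglyMeasurable
    (Filter.Eventually.of_forall fun x => norm_mul_le_weight hB f (t, x))

theorem cylPairing_eq_integral {a : ℝ × ℝ → ℂ} (ha : Continuous a) {B : ℝ}
    (hB : ∀ z, ‖a z‖ ≤ B) (f : SchwartzSpace) :
    cylPairing a f.1 = ∫ z, a z * f.1 z ∂cylMeasure := by
  rw [cylPairing, intervalIntegral.integral_of_le Real.two_pi_pos.le]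
  exact (integral_prod _ (integrable_mul_schwartz ha hB f)).symm

theorem cylPairing_eq_integral_swap {a : ℝ × ℝ → ℂ} (ha : Continuous a) {B : ℝ}
    (hB : ∀ z, ‖a z‖ ≤ B) (f : SchwartzSpace) :
    cylPairing a f.1 = ∫ x : ℝ, ∫ t in (0 : ℝ)..(2 * Real.pi), a (t, x) * f.1 (t, x) := by
  rw [cylPairing_eq_integral ha hB]
  simp only [intervalIntegral.integral_of_le Real.two_pi_pos.le]
  exact integral_prod_symm _ (integrable_mul_schwartz ha hB f)

theorem norm_cylPairing_le {a : ℝ × ℝ → ℂ} (ha : Continuous a) {B : ℝ}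
    (hB : ∀ z, ‖a z‖ ≤ B) (f : SchwartzSpace) :
    ‖cylPairing a f.1‖ ≤ B * (∫ z, (1 + z.2 ^ 2)⁻¹ ∂cylMeasure) * pNorm 2 f := by
  rw [cylPairing_eq_integral ha hB]
  refine (norm_integral_le_of_norm_le (integrable_weight.const_mul (B * pNorm 2 f))
    (Filter.Eventually.of_forall (norm_mul_le_weight hB f))).trans (le_of_eq ?_)
  rw [integral_const_mul]
  ring

/-- Smooth functions on `𝕋¹ × ℝ` that are bounded together with their first derivatives. -/
structure IsBoundedSymbol (a : ℝ × ℝ → ℂ) : Prop where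
  smooth : ContDiff ℝ ∞ a
  periodic : ∀ t x : ℝ, a (t + 2 * Real.pi, x) = a (t, x)
  bounded : ∃ B, ∀ z, ‖a z‖ ≤ B
  bounded_dt : ∃ B, ∀ z, ‖dt a z‖ ≤ B
  bounded_dx : ∃ B, ∀ z, ‖dx a z‖ ≤ B

theorem SchwartzSpace.bounded {f : ℝ × ℝ → ℂ} (h : f ∈ SchwartzSpace) : ∃ B, ∀ z, ‖f z‖ ≤ B := by
  simpa using SchwartzSpace.exists_bound h 0

theorem SchwartzSpace.isBoundedSymbol (f : SchwartzSpace) : IsBoundedSymbol f.1 :=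
  ⟨f.2.1, f.2.2.1, SchwartzSpace.bounded f.2, SchwartzSpace.bounded (SchwartzSpace.dt_mem f.2),
    SchwartzSpace.bounded (SchwartzSpace.dx_mem f.2)⟩

/-- Stated for bounded symbols so as to cover Schwartz functions and plane waves alike; decay of `f`
supplies the integrability for integration by parts on each line. -/
theorem IsBoundedSymbol.cylPairing_dx {a : ℝ × ℝ → ℂ} (ha : IsBoundedSymbol a)
    (f : SchwartzSpace) : cylPairing a (schwartzDx f).1 = -cylPairing (dx a) f.1 := by
  obtain ⟨B, hB⟩ := ha.bounded
  obtain ⟨B', hB'⟩ := ha.bounded_dx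
  rw [cylPairing, cylPairing, ← intervalIntegral.integral_neg]
  congr 1
  funext t
  exact integral_mul_deriv_eq_deriv_mul_of_integrable
    (fun x _ => hasDerivAt_dx ha.smooth t x) (fun x _ => hasDerivAt_dx f.2.1 t x)
    (integrable_mul_schwartz_line ha.smooth.continuous hB (schwartzDx f) t)
    (integrable_mul_schwartz_line (contDiff_dx ha.smooth).continuous hB' f t)
    (integrable_mul_schwartz_line ha.smooth.continuous hB f t)

/-- Fubini puts the `t`-integral inside, where periodicity of both factors cancels the boundary
terms. -/
theorem IsBoundedSymbol.cylPairing_dt {a : ℝ × ℝ → ℂ} (ha : IsBoundedSymbol a)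
    (f : SchwartzSpace) : cylPairing a (schwartzDt f).1 = -cylPairing (dt a) f.1 := by
  obtain ⟨B, hB⟩ := ha.bounded
  obtain ⟨B', hB'⟩ := ha.bounded_dt
  rw [cylPairing_eq_integral_swap ha.smooth.continuous hB,
    cylPairing_eq_integral_swap (contDiff_dt ha.smooth).continuous hB', ← integral_neg]
  congr 1
  funext x
  have hc : ∀ {g : ℝ × ℝ → ℂ}, ContDiff ℝ ∞ g → Continuous fun t => g (t, x) := fun hg =>
    hg.continuous.comp (continuous_id.prodMk continuous_const)
  have h := intervalIntegral.integral_mul_deriv_eq_deriv_mul (a := 0) (b := 2 * Real.pi)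
    (fun t _ => hasDerivAt_dt ha.smooth t x) (fun t _ => hasDerivAt_dt f.2.1 t x)
    ((hc (contDiff_dt ha.smooth)).intervalIntegrable _ _)
    ((hc (contDiff_dt f.2.1)).intervalIntegrable _ _)
  have e1 := ha.periodic 0 x
  have e2 := f.2.2.1 0 x
  rw [zero_add] at e1 e2
  rw [e1, e2, sub_self, zero_sub] at h
  exact h

/-- Integration against a bounded symbol, as a tempered distribution. -/
def IsBoundedSymbol.toDist {a : ℝ × ℝ → ℂ} (ha : IsBoundedSymbol a) : TemperedDistributions :=
  ⟨{  toFun := fun f => cylPairing a f.1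
      map_add' := fun f g => by
        obtain ⟨B, hB⟩ := ha.bounded
        have hc := ha.smooth.continuous
        rw [cylPairing_eq_integral hc hB, cylPairing_eq_integral hc hB,
          cylPairing_eq_integral hc hB,
          ← integral_add (integrable_mul_schwartz hc hB f) (integrable_mul_schwartz hc hB g)]
        exact integral_congr_ae (Filter.Eventually.of_forall fun z => mul_add _ _ _)
      map_smul' := fun c f => by
        obtain ⟨B, hB⟩ := ha.bounded
        have hc := ha.smooth.continuous
        rw [cylPairing_eq_integral hc hB, cylPairing_eq_integral hc hB, RingHom.id_apply,
          smul_eq_mul, ← integral_const_mul]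
        exact integral_congr_ae (Filter.Eventually.of_forall fun z => mul_left_comm _ _ _) }, by
    obtain ⟨B, hB⟩ := ha.bounded
    exact ⟨2, _, norm_cylPairing_le ha.smooth.continuous hB⟩⟩

/-- The embedding of the Schwartz space into the tempered distributions. -/
def schwartzToDist : SchwartzSpace →ₗ[ℂ] TemperedDistributions where
  toFun g := (SchwartzSpace.isBoundedSymbol g).toDist
  map_add' g h := by
    refine Subtype.ext (LinearMap.ext fun f => ?_)
    change cylPairing (g + h).1 f.1 = cylPairing g.1 f.1 + cylPairing h.1 f.1
    obtain ⟨A, hA⟩ := SchwartzSpace.bounded g.2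
    obtain ⟨B, hB⟩ := SchwartzSpace.bounded h.2
    obtain ⟨C, hC⟩ := SchwartzSpace.bounded (g + h).2
    rw [cylPairing_eq_integral (g + h).2.1.continuous hC,
      cylPairing_eq_integral g.2.1.continuous hA, cylPairing_eq_integral h.2.1.continuous hB,
      ← integral_add (integrable_mul_schwartz g.2.1.continuous hA f)
        (integrable_mul_schwartz h.2.1.continuous hB f)]
    exact integral_congr_ae (Filter.Eventually.of_forall fun z => add_mul _ _ _)
  map_smul' c g := by
    refine Subtype.ext (LinearMap.ext fun f => ?_)
    change cylPairing (c • g).1 f.1 = c * cylPairing g.1 f.1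
    obtain ⟨A, hA⟩ := SchwartzSpace.bounded g.2
    obtain ⟨C, hC⟩ := SchwartzSpace.bounded (c • g).2
    rw [cylPairing_eq_integral (c • g).2.1.continuous hC,
      cylPairing_eq_integral g.2.1.continuous hA, ← integral_const_mul]
    exact integral_congr_ae (Filter.Eventually.of_forall fun z => mul_assoc _ _ _)

theorem isSchwartz_iff {u : TemperedDistributions} :
    IsSchwartz u ↔ ∃ g : SchwartzSpace, u = schwartzToDist g :=
  exists_congr fun _ => ⟨fun h => Subtype.ext (LinearMap.ext h), fun h f => by rw [h]; rfl⟩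

theorem schwartzToDist_dx (g : SchwartzSpace) :
    schwartzToDist ((-Complex.I • schwartzDx) g) = (-Complex.I • distDx) (schwartzToDist g) := by
  rw [LinearMap.smul_apply, map_smul, LinearMap.smul_apply]
  congr 1
  refine Subtype.ext (LinearMap.ext fun f => ?_)
  change cylPairing (dx g.1) f.1 = -cylPairing g.1 (schwartzDx f).1
  rw [(SchwartzSpace.isBoundedSymbol g).cylPairing_dx, neg_neg]

theorem schwartzToDist_dt (g : SchwartzSpace) :
    schwartzToDist ((-Complex.I • schwartzDt) g) = (-Complex.I • distDt) (schwartzToDist g) := by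
  rw [LinearMap.smul_apply, map_smul, LinearMap.smul_apply]
  congr 1
  refine Subtype.ext (LinearMap.ext fun f => ?_)
  change cylPairing (dt g.1) f.1 = -cylPairing g.1 (schwartzDt f).1
  rw [(SchwartzSpace.isBoundedSymbol g).cylPairing_dt, neg_neg]

end Pairing

/-! ### Hypoellipticity by duality. -/

section Sufficiency

open Polynomial

/-- Transposition reverses products, which is harmless here because powers of a single operator
commute. -/
theorem aeval_apply_transpose {A : Module.End ℂ TemperedDistributions}
    {B : Module.End ℂ SchwartzSpace} (h : ∀ u f, (A u).1 f = u.1 (B f)) (p : ℂ[X])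
    (u : TemperedDistributions) (f : SchwartzSpace) : (aeval A p u).1 f = u.1 (aeval B p f) := by
  induction p using Polynomial.induction_on generalizing u f with
  | C a => simp [Algebra.algebraMap_eq_smul_one]
  | add p q hp hq => simp [hp, hq]
  | monomial n a ih =>
    rw [pow_succ, ← mul_assoc, map_mul _ (C a * X ^ n), aeval_X, Module.End.mul_apply, ih, h,
      mul_comm (C a * X ^ n) X, map_mul _ X, aeval_X, Module.End.mul_apply]

theorem aeval_comp_neg {V : Type*} [AddCommGroup V] [Module ℂ V] (A : Module.End ℂ V) (p : ℂ[X]) :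
    aeval A (p.comp (-X)) = aeval (-A) p := by
  rw [aeval_comp, map_neg, aeval_X]

/-- The transposes of `D_x` and `D_t` are their negatives, so the transpose of `L` has the reflected
polynomials `p(-X)` and `q(-X)`. -/
theorem constCoeffOp_apply (p q : ℂ[X]) (u : TemperedDistributions) (f : SchwartzSpace) :
    (constCoeffOp p q u).1 f = u.1 (aeval (-Complex.I • schwartzDx) (p.comp (-X)) f +
      aeval (-Complex.I • schwartzDt) (q.comp (-X)) f) := by
  rw [aeval_comp_neg, aeval_comp_neg, map_add, ← aeval_apply_transpose (A := -Complex.I • distDx),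
    ← aeval_apply_transpose (A := -Complex.I • distDt)]
  · rfl
  · intro u f
    change -Complex.I * -(u.1 (schwartzDt f)) = u.1 (-(-Complex.I • schwartzDt f))
    simp
  · intro u f
    change -Complex.I * -(u.1 (schwartzDx f)) = u.1 (-(-Complex.I • schwartzDx f))
    simp

/-- Surjectivity of `L` on the Schwartz space yields a Schwartz solution `w`; surjectivity of its
transpose yields injectivity of `L` on distributions, so `u = w`. -/
theorem schwartzGloballyHypoelliptic_of_le {p q : ℂ[X]} {c : ℝ} (hc : 0 < c)
    (h : ∀ (k : ℤ) (ξ : ℝ), c ≤ ‖p.eval (ξ : ℂ) + q.eval (k : ℂ)‖) :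
    SchwartzGloballyHypoelliptic (constCoeffOp p q) := by
  intro u hu
  obtain ⟨g, hg⟩ := isSchwartz_iff.1 hu
  obtain ⟨w, hw⟩ := exists_schwartz_solution hc h g
  refine isSchwartz_iff.2 ⟨w, sub_eq_zero.1 ?_⟩
  have hLw : constCoeffOp p q (schwartzToDist w) = schwartzToDist g := by
    rw [← hw, map_add, map_aeval_apply schwartzToDist schwartzToDist_dx,
      map_aeval_apply schwartzToDist schwartzToDist_dt]
    rfl
  have hker : constCoeffOp p q (u - schwartzToDist w) = 0 := by
    rw [map_sub, hLw, hg, sub_self]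
  refine Subtype.ext (LinearMap.ext fun f => ?_)
  -- The reflected symbol at `(k, ξ)` is the original one at `(-k, -ξ)`, so the same `c` works.
  obtain ⟨e, he⟩ := exists_schwartz_solution (p := p.comp (-X)) (q := q.comp (-X)) hc
    (fun k ξ => by simpa using h (-k) (-ξ)) f
  rw [← he, ← constCoeffOp_apply, hker]
  rfl

end Sufficiency

/-! ### Plane waves at zeros of the symbol. -/

section Necessity

open MeasureTheory SchwartzMap

/-- The plane wave `e^{i(kt + ξx)}`. -/
def planeWave (k : ℤ) (ξ : ℝ) (z : ℝ × ℝ) : ℂ := torusChar k z.1 * Complex.exp (ξ * Complex.I * z.2)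

theorem norm_exp_mul_I_mul (ξ x : ℝ) : ‖Complex.exp (ξ * Complex.I * x)‖ = 1 := by
  have : (ξ * Complex.I * x : ℂ) = ((ξ * x : ℝ) : ℂ) * Complex.I := by
    push_cast
    ring
  rw [this, Complex.norm_exp_ofReal_mul_I]

theorem norm_planeWave (k : ℤ) (ξ : ℝ) (z : ℝ × ℝ) : ‖planeWave k ξ z‖ = 1 := by
  rw [planeWave, norm_mul, norm_torusChar, norm_exp_mul_I_mul, one_mul]

theorem contDiff_exp_mul_I_mul (ξ : ℝ) :
    ContDiff ℝ ∞ fun x : ℝ => Complex.exp (ξ * Complex.I * x) :=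
  (contDiff_const.mul Complex.ofRealCLM.contDiff).cexp

theorem dt_planeWave (k : ℤ) (ξ : ℝ) :
    dt (planeWave k ξ) = (k * Complex.I : ℂ) • planeWave k ξ := by
  funext z
  refine ((hasDerivAt_torusChar k z.1).mul_const
    (Complex.exp (ξ * Complex.I * z.2))).deriv.trans ?_
  simp [planeWave, mul_assoc]

theorem dx_planeWave (k : ℤ) (ξ : ℝ) :
    dx (planeWave k ξ) = (ξ * Complex.I : ℂ) • planeWave k ξ := by
  funext z
  have h := ((((hasDerivAt_id (z.2 : ℂ)).const_mul (ξ * Complex.I)).cexp).comp_ofReal).const_mul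
    (torusChar k z.1)
  refine h.deriv.trans ?_
  simp [planeWave]
  ring

theorem isBoundedSymbol_planeWave (k : ℤ) (ξ : ℝ) : IsBoundedSymbol (planeWave k ξ) where
  smooth := ((contDiff_torusChar k).comp contDiff_fst).mul
    ((contDiff_exp_mul_I_mul ξ).comp contDiff_snd)
  periodic t x := by simp only [planeWave, torusChar_add_two_pi]
  bounded := ⟨1, fun z => (norm_planeWave k ξ z).le⟩
  bounded_dt := ⟨‖(k * Complex.I : ℂ)‖ * 1, fun z => by
    rw [dt_planeWave, Pi.smul_apply, norm_smul, norm_planeWave]⟩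
  bounded_dx := ⟨‖(ξ * Complex.I : ℂ)‖ * 1, fun z => by
    rw [dx_planeWave, Pi.smul_apply, norm_smul, norm_planeWave]⟩

theorem cylPairing_smul_left (c : ℂ) (a f : ℝ × ℝ → ℂ) :
    cylPairing (c • a) f = c * cylPairing a f := by
  simp only [cylPairing, Pi.smul_apply, smul_eq_mul, mul_assoc]
  simp only [integral_const_mul, intervalIntegral.integral_const_mul]

theorem constCoeffOp_planeWave (p q : Polynomial ℂ) (k : ℤ) (ξ : ℝ) :
    constCoeffOp p q (isBoundedSymbol_planeWave k ξ).toDist =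
      (p.eval (ξ : ℂ) + q.eval (k : ℂ)) • (isBoundedSymbol_planeWave k ξ).toDist := by
  have hx : (-Complex.I • distDx) (isBoundedSymbol_planeWave k ξ).toDist =
      (ξ : ℂ) • (isBoundedSymbol_planeWave k ξ).toDist := by
    refine Subtype.ext (LinearMap.ext fun f => ?_)
    change -Complex.I * -cylPairing (planeWave k ξ) (schwartzDx f).1 =
      ξ * cylPairing (planeWave k ξ) f.1
    rw [(isBoundedSymbol_planeWave k ξ).cylPairing_dx, dx_planeWave, cylPairing_smul_left]
    linear_combination (-ξ * cylPairing (planeWave k ξ) f.1) * Complex.I_mul_I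
  have ht : (-Complex.I • distDt) (isBoundedSymbol_planeWave k ξ).toDist =
      (k : ℂ) • (isBoundedSymbol_planeWave k ξ).toDist := by
    refine Subtype.ext (LinearMap.ext fun f => ?_)
    change -Complex.I * -cylPairing (planeWave k ξ) (schwartzDt f).1 =
      k * cylPairing (planeWave k ξ) f.1
    rw [(isBoundedSymbol_planeWave k ξ).cylPairing_dt, dt_planeWave, cylPairing_smul_left]
    linear_combination (-k * cylPairing (planeWave k ξ) f.1) * Complex.I_mul_I
  rw [constCoeffOp, LinearMap.add_apply, aeval_apply_of_apply_eq_smul hx,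
    aeval_apply_of_apply_eq_smul ht, add_smul]

theorem single_mem_rapidFamilies (k : ℤ) (φ : 𝓢(ℝ, ℂ)) :
    (Pi.single k φ : ℤ → 𝓢(ℝ, ℂ)) ∈ RapidFamilies := by
  intro N a n
  refine ⟨SchwartzMap.seminorm ℂ a n ((k : ℂ) ^ N • φ), fun j => ?_⟩
  rcases eq_or_ne j k with rfl | hj
  · simp
  · simp [Pi.single_eq_of_ne hj, apply_nonneg]

/-- Synthesis of a family with one nonzero member, which spares a direct check of the Schwartz
bounds. -/
theorem exists_schwartz_torusChar_mul (k : ℤ) (φ : 𝓢(ℝ, ℂ)) :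
    ∃ f : SchwartzSpace, ∀ t x : ℝ, f.1 (t, x) = torusChar k t * φ x := by
  refine ⟨schwartzSynth ⟨_, single_mem_rapidFamilies k φ⟩, fun t x => ?_⟩
  refine (tsum_eq_single k fun j hj => ?_).trans ?_
  · simp [synthTerm, Pi.single_eq_of_ne hj]
  · simp [synthTerm]

/-- The test function is the conjugate plane wave times a bump equal to 1 on `[-R, R]`. The
oscillations cancel in the pairing, leaving `2π` times the bump's integral `I`. -/
theorem exists_schwartz_cutoff (k : ℤ) (ξ : ℝ) {R : ℝ} (hR : 0 < R) :
    ∃ (f : SchwartzSpace) (I : ℝ), (∀ z, ‖f.1 z‖ ≤ 1) ∧ 2 * R ≤ I ∧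
      cylPairing (planeWave k ξ) f.1 = ((2 * Real.pi * I : ℝ) : ℂ) := by
  let b : ContDiffBump (0 : ℝ) := ⟨R, R + 1, hR, by linarith⟩
  have hsupp : HasCompactSupport fun x : ℝ =>
      Complex.exp ((-ξ : ℝ) * Complex.I * x) * ((b x : ℝ) : ℂ) :=
    (b.hasCompactSupport.comp_left Complex.ofReal_zero).mul_left
  have hsm : ContDiff ℝ ∞ fun x : ℝ => Complex.exp ((-ξ : ℝ) * Complex.I * x) * ((b x : ℝ) : ℂ) :=
    (contDiff_exp_mul_I_mul (-ξ)).mul (Complex.ofRealCLM.contDiff.comp b.contDiff)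
  obtain ⟨f, hf⟩ := exists_schwartz_torusChar_mul (-k) (hsupp.toSchwartzMap hsm)
  have hf' : ∀ t x, f.1 (t, x) =
      torusChar (-k) t * (Complex.exp ((-ξ : ℝ) * Complex.I * x) * ((b x : ℝ) : ℂ)) := hf
  refine ⟨f, ∫ x, b x, fun z => ?_, ?_, ?_⟩
  · rw [show z = (z.1, z.2) from rfl, hf', norm_mul, norm_torusChar, norm_mul, norm_exp_mul_I_mul,
      one_mul, one_mul, Complex.norm_real, Real.norm_of_nonneg b.nonneg]
    exact b.le_one
  · refine le_trans (le_of_eq ?_) (b.measure_closedBall_le_integral volume)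
    rw [measureReal_def, Real.volume_closedBall, ENNReal.toReal_ofReal]
    · positivity
  · have hint : ∀ t x : ℝ, planeWave k ξ (t, x) * f.1 (t, x) = ((b x : ℝ) : ℂ) := by
      intro t x
      have h1 := torusChar_neg_mul k t
      have h2 : Complex.exp ((-ξ : ℝ) * Complex.I * x) * Complex.exp (ξ * Complex.I * x) = 1 := by
        rw [← Complex.exp_add]
        simp
      rw [hf', planeWave]
      linear_combination (Complex.exp ((-ξ : ℝ) * Complex.I * x) *
        Complex.exp (ξ * Complex.I * x) * b x) * h1 + (b x : ℂ) * h2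
    simp only [cylPairing, hint]
    rw [integral_complex_ofReal, intervalIntegral.integral_const]
    simp

theorem not_isSchwartz_planeWave (k : ℤ) (ξ : ℝ) :
    ¬ IsSchwartz (isBoundedSymbol_planeWave k ξ).toDist := by
  rintro ⟨g, hg⟩
  set K : ℝ := ∫ z, pNorm 2 g * (1 + z.2 ^ 2)⁻¹ ∂cylMeasure with hK
  -- `K` bounds the integral of `|g|`, hence the pairing of `g` with `f`. This radius makes `2πI ≥ I
  -- ≥ 2(|K| + 1) > K`.
  obtain ⟨f, I, hf1, hI, hfI⟩ := exists_schwartz_cutoff k ξ (R := |K| + 1) (by positivity)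
  obtain ⟨B, hB⟩ := SchwartzSpace.bounded g.2
  have h1 : cylPairing (planeWave k ξ) f.1 = cylPairing g.1 f.1 := hg f
  have h2 : ‖cylPairing g.1 f.1‖ ≤ K := by
    rw [cylPairing_eq_integral g.2.1.continuous hB]
    refine norm_integral_le_of_norm_le (integrable_weight.const_mul (pNorm 2 g))
      (Filter.Eventually.of_forall fun z => ?_)
    rw [norm_mul]
    exact (mul_le_of_le_one_right (norm_nonneg _) (hf1 z)).trans (norm_le_pNorm g z)
  have hpi : 1 ≤ 2 * Real.pi := by linarith [Real.two_le_pi]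
  have hI0 : 0 ≤ I := le_trans (by positivity) hI
  rw [← h1, hfI, Complex.norm_real, Real.norm_of_nonneg (by positivity)] at h2
  have h3 : I ≤ 2 * Real.pi * I := le_mul_of_one_le_left hI0 hpi
  linarith [le_abs_self K, abs_nonneg K]

theorem symbol_ne_zero_of_schwartzGloballyHypoelliptic {p q : Polynomial ℂ}
    (h : SchwartzGloballyHypoelliptic (constCoeffOp p q)) (k : ℤ) (ξ : ℝ) :
    p.eval (ξ : ℂ) + q.eval (k : ℂ) ≠ 0 := by
  intro h0
  refine not_isSchwartz_planeWave k ξ (h _ ?_)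
  rw [constCoeffOp_planeWave, h0, zero_smul]
  exact isSchwartz_iff.2 ⟨0, (map_zero schwartzToDist).symm⟩

end Necessity

end TorusLine

end

theorem mainTheorem1 (p q : Polynomial ℂ)
    (hp : 0 < p.natDegree) (hq : 0 < q.natDegree)
    (hreal : (∀ n : ℕ, (p.coeff n).im = 0) ∨ (∀ n : ℕ, (q.coeff n).im = 0)) :
    TorusLine.SchwartzGloballyHypoelliptic (TorusLine.constCoeffOp p q) ↔
      ∀ (k : ℤ) (ξ : ℝ), p.eval (ξ : ℂ) + q.eval (k : ℂ) ≠ 0 := by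
  refine ⟨TorusLine.symbol_ne_zero_of_schwartzGloballyHypoelliptic, fun h => ?_⟩
  obtain ⟨c, hc, hle⟩ := TorusLine.exists_le_norm_symbol hp hq hreal h
  exact TorusLine.schwartzGloballyHypoelliptic_of_le hc hle
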